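/- Let $\mathfrak{g}=\mathfrak{sl}(3,\mathbb{C})$, and let $e_{ij}$ be the matrix unit with $(i,j)$ entry $1$ and all other entries $0$. Put \[ H_1=\tfrac13(2e_{11}-e_{22}-e_{33}),\quad H_2=\tfrac13(-e_{11}+2e_{22}-e_{33}),\quad H=H_1-H_2, \] \[ E=e_{12},\quad F=e_{21},\quad E_1=e_{13},\quad E_2=e_{23},\quad F_1=e_{31},\quad F_2=e_{32}. \] Let $\mathfrak{p}=\operatorname{span}_{\mathbb{C}}\{E_1,E_2,F_1,F_2\}\subset\mathfrak{g}$. Let $K=S(U(2)\times U(1))$ be the group of block diagonal unitary $3\times 3$ matrices of determinant $1$ with diagonal blocks of sizes $2$ and $1$; it is a maximal compact subgroup of $SU(2,1)$. The group $K$ acts on $\mathfrak{g}$ and on $\mathfrak{p}$ by $\operatorname{Ad}(k)X=kXk^{-1}$, hence by algebra automorphisms on the symmetric algebra $S(\mathfrak{g})$, on the exterior algebra $\bigwedge(\mathfrak{p})$, and diagonally on the tensor product algebra $S(\mathfrak{g})\otimes\bigwedge(\mathfrak{p})$ (over $\mathbb{C}$, with $(x\otimes\omega)(y\otimes\eta)=xy\otimes\omega\wedge\eta$).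 A superscript $K$ denotes the subalgebra of $K$-invariants. In $S(\mathfrak{g})$ let \begin{align*} a&=H_1+H_2,\qquad b=H^2+4EF,\qquad c=E_1F_1+E_2F_2,\\ d&=2EE_2F_1+HE_1F_1-HE_2F_2+2FE_1F_2, \end{align*} and in $S(\mathfrak{g})\otimes\bigwedge(\mathfrak{p})$ let \begin{align*} e&=F_1\otimes E_1+F_2\otimes E_2,\\ f&=E_1\otimes F_1+E_2\otimes F_2,\\ g&=1\otimes(E_1\wedge F_1+E_2\wedge F_2),\\ h&=(2EE_2+HE_1)\otimes F_1+(-HE_2+2FE_1)\otimes F_2,\\ i&=2E\otimes E_2\wedge F_1+H\otimes E_1\wedge F_1-H\otimes E_2\wedge F_2+2F\otimes E_1\wedge F_2,\\ j&=(HF_1+2FF_2)\otimes E_1+(2EF_1-HF_2)\otimes E_2, \end{align*} \[ T=\{1,\,e,\,f,\,g,\,h,\,i,\,j,\,ef,\,eg,\,fg,\,g^2,\,ei,\,ej,\,fh,\,fi,\,fj\}. \] Then: 1. $S(\mathfrak{g})^K$ is a polynomial algebra generated by $a,b,c,d$; that is, $a,b,c,d$ are algebraically independent over $\mathbb{C}$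 and generate the algebra $S(\mathfrak{g})^K$. 2. The algebra $(S(\mathfrak{g})\otimes\bigwedge(\mathfrak{p}))^K$, regarded as a module over $S(\mathfrak{g})^K=S(\mathfrak{g})^K\otimes 1$ by multiplication, is free of rank $16$, and the $16$ elements of $T$ form a basis of it. -/

import Mathlib

open scoped TensorProduct

noncomputable section

namespace SU21

/-- The complex Lie algebra `𝔤 = 𝔰𝔩(3, ℂ)`. -/
abbrev 𝔤 := LieAlgebra.SpecialLinear.sl (Fin 3) ℂ

theorem mem_g_iff (X : Matrix (Fin 3) (Fin 3) ℂ) :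
    X ∈ LieAlgebra.SpecialLinear.sl (Fin 3) ℂ ↔ X.trace = 0 := Iff.rfl

/-! ### The standard basis of `𝔤` -/

/-- The matrix unit with a `1` at position `(i, j)` (indices start at `0`). -/
def unit (i j : Fin 3) : Matrix (Fin 3) (Fin 3) ℂ := Matrix.single i j 1

/-- An off-diagonal matrix unit as an element of `𝔤`. -/
def offDiag (i j : Fin 3) (h : i ≠ j) : 𝔤 :=
  ⟨unit i j, by rw [mem_g_iff, unit, Matrix.trace_single_eq_of_ne i j 1 h]⟩

def H₁ : 𝔤 := ⟨(1 / 3 : ℂ) • ((2 : ℂ) • unit 0 0 - unit 1 1 - unit 2 2), by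
  rw [mem_g_iff]; simp [unit, Matrix.trace_sub, Matrix.trace_smul]; norm_num⟩

def H₂ : 𝔤 := ⟨(1 / 3 : ℂ) • (-unit 0 0 + (2 : ℂ) • unit 1 1 - unit 2 2), by
  rw [mem_g_iff]; simp [unit, Matrix.trace_sub, Matrix.trace_add, Matrix.trace_smul]; norm_num⟩

def E : 𝔤 := offDiag 0 1 (by decide)
def F : 𝔤 := offDiag 1 0 (by decide)
def E₁ : 𝔤 := offDiag 0 2 (by decide)
def E₂ : 𝔤 := offDiag 1 2 (by decide)
def F₁ : 𝔤 := offDiag 2 0 (by decide)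
def F₂ : 𝔤 := offDiag 2 1 (by decide)

def H : 𝔤 := H₁ - H₂

/-! ### The group `K` and its adjoint action on `𝔤` -/

/-- The maximal compact subgroup `K = S(U(2) × U(1))` of `SU(2, 1)`: the block diagonal
unitary matrices of determinant one with blocks of size `2` and `1`. -/
def K : Subgroup (Matrix.SpecialLinearGroup (Fin 3) ℂ) where
  carrier := {k | (k : Matrix (Fin 3) (Fin 3) ℂ) ∈ Matrix.unitaryGroup (Fin 3) ℂ ∧
    k 0 2 = 0 ∧ k 1 2 = 0 ∧ k 2 0 = 0 ∧ k 2 1 = 0}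
  one_mem' := by
    refine ⟨?_, ?_, ?_, ?_, ?_⟩ <;> simp [one_mem]
  mul_mem' := by
    rintro x y ⟨hx, h1, h2, h3, h4⟩ ⟨hy, g1, g2, g3, g4⟩
    refine ⟨?_, ?_, ?_, ?_, ?_⟩
    · rw [Matrix.SpecialLinearGroup.coe_mul]; exact mul_mem hx hy
    all_goals
      rw [Matrix.SpecialLinearGroup.coe_mul, Matrix.mul_apply, Fin.sum_univ_three]
      simp [h1, h2, h3, h4, g1, g2, g3, g4]
  inv_mem' := by
    rintro x ⟨hx, h1, h2, h3, h4⟩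
    have hinv : ((x⁻¹ : Matrix.SpecialLinearGroup (Fin 3) ℂ) : Matrix (Fin 3) (Fin 3) ℂ)
        = star (x : Matrix (Fin 3) (Fin 3) ℂ) := by
      have e1 : ((x⁻¹ : Matrix.SpecialLinearGroup (Fin 3) ℂ) : Matrix (Fin 3) (Fin 3) ℂ)
          * (x : Matrix (Fin 3) (Fin 3) ℂ) = 1 := by
        rw [← Matrix.SpecialLinearGroup.coe_mul, inv_mul_cancel,
          Matrix.SpecialLinearGroup.coe_one]
      have e2 := Matrix.mem_unitaryGroup_iff.mp hx
      exact left_inv_eq_right_inv e1 e2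
    refine ⟨?_, ?_, ?_, ?_, ?_⟩
    · rw [hinv]; exact Unitary.star_mem hx
    all_goals
      rw [hinv, Matrix.star_apply]
      simp [h1, h2, h3, h4]

/-- `γ = diag(1, 1, -1)`, the Hermitian form that defines `SU(2, 1)`. -/
def γ : Matrix (Fin 3) (Fin 3) ℂ := Matrix.diagonal ![1, 1, -1]

/-- `K` is the fixed point group of the Cartan involution `g ↦ (g*)⁻¹` on
`SU(2, 1) = {g ∈ SL(3, ℂ) | g* γ g = γ}`. -/
theorem mem_K_iff (k : Matrix.SpecialLinearGroup (Fin 3) ℂ) :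
    k ∈ K ↔ star (k : Matrix (Fin 3) (Fin 3) ℂ) * γ * k = γ ∧
      star (k : Matrix (Fin 3) (Fin 3) ℂ) * k = 1 := by
  have hcomm : (k : Matrix (Fin 3) (Fin 3) ℂ) * γ = γ * k ↔
      (k 0 2 = 0 ∧ k 1 2 = 0 ∧ k 2 0 = 0 ∧ k 2 1 = 0) := by
    simp only [γ, ← Matrix.ext_iff, Matrix.mul_diagonal, Matrix.diagonal_mul,
      Fin.forall_fin_succ, IsEmpty.forall_iff]
    simp [neg_eq_iff_add_eq_zero, eq_neg_iff_add_eq_zero, ← two_mul]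
  constructor
  · rintro ⟨hu, h⟩
    have hu' := Matrix.mem_unitaryGroup_iff'.mp hu
    refine ⟨?_, hu'⟩
    rw [mul_assoc, ← hcomm.mpr h, ← mul_assoc, hu', one_mul]
  · rintro ⟨h1, h2⟩
    refine ⟨Matrix.mem_unitaryGroup_iff'.mpr h2, hcomm.mp ?_⟩
    have h3 := Matrix.mem_unitaryGroup_iff.mp (Matrix.mem_unitaryGroup_iff'.mpr h2)
    calc (k : Matrix (Fin 3) (Fin 3) ℂ) * γ
        = k * (star (k : Matrix (Fin 3) (Fin 3) ℂ) * γ * k) := by rw [h1]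
      _ = (k * star (k : Matrix (Fin 3) (Fin 3) ℂ)) * γ * k := by simp only [mul_assoc]
      _ = γ * k := by rw [h3, one_mul]

/-- The adjoint action `Ad(k) X = k X k⁻¹` on `𝔤`. -/
def Ad (k : K) : 𝔤 →ₗ[ℂ] 𝔤 where
  toFun X := ⟨(k : Matrix.SpecialLinearGroup (Fin 3) ℂ).1 * X.1 *
      ((k : Matrix.SpecialLinearGroup (Fin 3) ℂ)⁻¹).1, by
    rw [mem_g_iff, Matrix.trace_mul_comm, ← mul_assoc]
    have : ((k : Matrix.SpecialLinearGroup (Fin 3) ℂ)⁻¹).1 *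
        (k : Matrix.SpecialLinearGroup (Fin 3) ℂ).1 = 1 := by
      have := congrArg Subtype.val (inv_mul_cancel (k : Matrix.SpecialLinearGroup (Fin 3) ℂ))
      simpa only [Matrix.SpecialLinearGroup.coe_mul, Matrix.SpecialLinearGroup.coe_one] using this
    rw [this, one_mul]
    exact X.2⟩
  map_add' X Y := Subtype.ext (by simp [mul_add, add_mul])
  map_smul' c X := Subtype.ext (by simp)

/-- The complexified noncompact part `𝔭` of the Cartan decomposition `𝔤 = 𝔨 ⊕ 𝔭`. -/
def 𝔭 : Submodule ℂ 𝔤 := Submodule.span ℂ {E₁, E₂, F₁, F₂}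

theorem mem_p_iff (X : 𝔤) : X ∈ 𝔭 ↔
    X.1 0 0 = 0 ∧ X.1 0 1 = 0 ∧ X.1 1 0 = 0 ∧ X.1 1 1 = 0 ∧ X.1 2 2 = 0 := by
  constructor
  · intro hX
    induction hX using Submodule.span_induction with
    | mem x hx =>
      rcases hx with rfl | rfl | rfl | rfl <;>
        simp [E₁, E₂, F₁, F₂, offDiag, unit]
    | zero => simp
    | add x y _ _ hx hy => simp_all
    | smul c x _ hx => simp_all
  · rintro ⟨h1, h2, h3, h4, h5⟩
    have : X = X.1 0 2 • E₁ + X.1 1 2 • E₂ + X.1 2 0 • F₁ + X.1 2 1 • F₂ := by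
      apply Subtype.ext
      ext i j
      fin_cases i <;> fin_cases j <;>
        simp [E₁, E₂, F₁, F₂, offDiag, unit, h1, h2, h3, h4, h5]
    rw [this]
    refine add_mem (add_mem (add_mem ?_ ?_) ?_) ?_ <;>
      exact Submodule.smul_mem _ _ (Submodule.subset_span (by simp))

theorem Ad_mem_p (k : K) (X : 𝔤) (hX : X ∈ 𝔭) : Ad k X ∈ 𝔭 := by
  rw [mem_p_iff] at hX ⊢
  obtain ⟨a1, a2, a3, a4, a5⟩ := hX
  obtain ⟨-, k1, k2, k3, k4⟩ := k.2
  obtain ⟨-, l1, l2, l3, l4⟩ := (k⁻¹).2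
  simp only [Subgroup.coe_inv] at l1 l2 l3 l4
  simp only [Ad, LinearMap.coe_mk, AddHom.coe_mk, Matrix.mul_apply, Fin.sum_univ_three]
  simp [a1, a2, a3, a4, a5, k1, k2, k3, k4, l1, l2, l3, l4]

/-- The adjoint action of `K` on `𝔭`. -/
def Adp (k : K) : 𝔭 →ₗ[ℂ] 𝔭 := (Ad k).restrict (Ad_mem_p k)

/-! ### The algebras `S(𝔤)`, `⋀(𝔭)` and `S(𝔤) ⊗ ⋀(𝔭)` with their `K`-actions -/

/-- The symmetric algebra `S(𝔤)`. -/
abbrev S := SymmetricAlgebra ℂ 𝔤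

/-- The exterior algebra `⋀(𝔭)`. -/
abbrev Λ := ExteriorAlgebra ℂ 𝔭

/-- The action of `k ∈ K` on `S(𝔤)` by algebra automorphisms that extends `Ad`. -/
def actS (k : K) : S →ₐ[ℂ] S := SymmetricAlgebra.lift (SymmetricAlgebra.ι ℂ 𝔤 ∘ₗ Ad k)

/-- The action of `k ∈ K` on `⋀(𝔭)` by algebra automorphisms that extends `Ad`. -/
def actΛ (k : K) : Λ →ₐ[ℂ] Λ := ExteriorAlgebra.map (Adp k)

/-- The diagonal action `Ad ⊗ Ad` of `k ∈ K` on the tensor product algebra `S(𝔤) ⊗ ⋀(𝔭)`. -/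
def act (k : K) : S ⊗[ℂ] Λ →ₐ[ℂ] S ⊗[ℂ] Λ := Algebra.TensorProduct.map (actS k) (actΛ k)

/-- `S(𝔤)^K`. -/
def invS : Subalgebra ℂ S := ⨅ k : K, AlgHom.equalizer (actS k) (AlgHom.id ℂ S)

theorem mem_invS_iff (x : S) : x ∈ invS ↔ ∀ k : K, actS k x = x := by
  simp [invS, Algebra.mem_iInf, AlgHom.mem_equalizer]

/-- `(S(𝔤) ⊗ ⋀(𝔭))^K`. -/
def inv : Subalgebra ℂ (S ⊗[ℂ] Λ) :=
  ⨅ k : K, AlgHom.equalizer (act k) (AlgHom.id ℂ (S ⊗[ℂ] Λ))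

theorem mem_inv_iff (x : S ⊗[ℂ] Λ) : x ∈ inv ↔ ∀ k : K, act k x = x := by
  simp [inv, Algebra.mem_iInf, AlgHom.mem_equalizer]

/-- The embedding `S(𝔤)^K → (S(𝔤) ⊗ ⋀(𝔭))^K`, `s ↦ s ⊗ 1`. -/
def invIncl : invS →ₐ[ℂ] inv :=
  ((Algebra.TensorProduct.includeLeft : S →ₐ[ℂ] S ⊗[ℂ] Λ).comp invS.val).codRestrict inv (by
    intro s
    have hs := (mem_invS_iff s.1).mp s.2
    rw [mem_inv_iff]
    intro k
    simp [act, hs k])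

/-- `(S(𝔤) ⊗ ⋀(𝔭))^K` is a module over `S(𝔤)^K = S(𝔤)^K ⊗ 1` by multiplication. -/
instance invModule : Module invS inv := Module.compHom inv invIncl.toRingHom

theorem coe_smul_inv (s : invS) (x : inv) :
    ((s • x : inv) : S ⊗[ℂ] Λ) = ((s : S) ⊗ₜ[ℂ] (1 : Λ)) * (x : S ⊗[ℂ] Λ) := rfl

/-! ### The explicit invariants -/

/-- An element of `𝔤` viewed in `S(𝔤)`. -/
abbrev s (X : 𝔤) : S := SymmetricAlgebra.ι ℂ 𝔤 X

/-- The elements `E₁, E₂, F₁, F₂` of `𝔭`, viewed in `⋀(𝔭)`. -/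
def ε₁ : Λ := ExteriorAlgebra.ι ℂ (⟨E₁, Submodule.subset_span (by simp)⟩ : 𝔭)
def ε₂ : Λ := ExteriorAlgebra.ι ℂ (⟨E₂, Submodule.subset_span (by simp)⟩ : 𝔭)
def φ₁ : Λ := ExteriorAlgebra.ι ℂ (⟨F₁, Submodule.subset_span (by simp)⟩ : 𝔭)
def φ₂ : Λ := ExteriorAlgebra.ι ℂ (⟨F₂, Submodule.subset_span (by simp)⟩ : 𝔭)

def a : S := s (H₁ + H₂)
def b : S := s H ^ 2 + 4 * s E * s F
def c : S := s E₁ * s F₁ + s E₂ * s F₂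
def d : S := 2 * s E * s E₂ * s F₁ + s H * s E₁ * s F₁ - s H * s E₂ * s F₂ + 2 * s F * s E₁ * s F₂

def e : S ⊗[ℂ] Λ := s F₁ ⊗ₜ ε₁ + s F₂ ⊗ₜ ε₂
def f : S ⊗[ℂ] Λ := s E₁ ⊗ₜ φ₁ + s E₂ ⊗ₜ φ₂
def g : S ⊗[ℂ] Λ := 1 ⊗ₜ (ε₁ * φ₁ + ε₂ * φ₂)
def h : S ⊗[ℂ] Λ :=
  (2 * s E * s E₂ + s H * s E₁) ⊗ₜ φ₁ + (-(s H * s E₂) + 2 * s F * s E₁) ⊗ₜ φ₂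
def i : S ⊗[ℂ] Λ :=
  (2 * s E) ⊗ₜ (ε₂ * φ₁) + s H ⊗ₜ (ε₁ * φ₁) - s H ⊗ₜ (ε₂ * φ₂) + (2 * s F) ⊗ₜ (ε₁ * φ₂)
def j : S ⊗[ℂ] Λ :=
  (s H * s F₁ + 2 * s F * s F₂) ⊗ₜ ε₁ + (2 * s E * s F₁ - s H * s F₂) ⊗ₜ ε₂

/-- The list `T` of sixteen elements of `S(𝔤) ⊗ ⋀(𝔭)`. -/
def T : Fin 16 → S ⊗[ℂ] Λ :=
  ![1, e, f, g, h, i, j, e * f, e * g, f * g, g ^ 2, e * i, e * j, f * h, f * i, f * j]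

end SU21

end

noncomputable section

namespace SU21

/-! Scalar matrices act trivially by conjugation, so `K` acts through matrices diag(u, 1), and it is
Zariski dense in the resulting GL(2, ℂ): both groups have the same invariants (`mem_inv_iff_actG`).
The trace form turns S(𝔤) into the polynomial functions of a 3 × 3 matrix Y modulo scalars. With V =
ℂ², an element of S(𝔤) ⊗ ⋀(𝔭) becomes a polynomial map from such Y to ⋀(V ⊕ V*), that is, sixteen
coefficients `cf x n`. Invariance means equivariance under Y ↦ u⁻¹ Y u (`cf_covariant`).

Let v be the upper part of the last column of Y, w the left part of its last row, and N twice the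
traceless part of its upper block. Then N² = b, wv = c and wNv = d. Where δv = det(v, Nv) ≠ 0, the
frame u = (v | Nv) brings Y to a normal form depending only on a, b, c, d (`exists_frameV`). An
equivariant map is therefore recovered from its restriction to the slice `slV`, whose entries are
polynomials in a, b, c, d. The rows w, wN give a second slice `slW` (`exists_frameW`). Since a, b,
c, d restrict to the coordinates of `slV`, they are algebraically independent; the scalar component
shows that they generate.

Transport back from a slice involves u and u⁻¹. For V, Λ²V and Λ²V ⊗ V* the frame (v | Nv) leaves no
denominator, because det u · u⁻¹ is an adjugate; the dual components use (w; wN). The resulting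
polynomial identities hold off a hypersurface, hence everywhere. The component V ⊗ V* is the one
where neither frame suffices: using `slW`, one subtracts p + qN to reach a matrix whose rows are
multiples of w, divides by w because E₁ is prime and does not divide E₂, and expands the remaining
column in v, Nv by means of `slV` (`exists_block`). Independence follows from the nonvanishing of δv
and δw = det(w, wN). -/

/-! ### Relations and standard monomials in the exterior algebra -/

theorem ε₁_sq : ε₁ * ε₁ = 0 := ExteriorAlgebra.ι_sq_zero _
theorem ε₂_sq : ε₂ * ε₂ = 0 := ExteriorAlgebra.ι_sq_zero _
theorem φ₁_sq : φ₁ * φ₁ = 0 := ExteriorAlgebra.ι_sq_zero _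
theorem φ₂_sq : φ₂ * φ₂ = 0 := ExteriorAlgebra.ι_sq_zero _

theorem ι_mul_ι_swap (x y : 𝔭) :
    ExteriorAlgebra.ι ℂ x * ExteriorAlgebra.ι ℂ y =
      -(ExteriorAlgebra.ι ℂ y * ExteriorAlgebra.ι ℂ x) :=
  eq_neg_of_add_eq_zero_left (ExteriorAlgebra.ι_add_mul_swap x y)

theorem ε₂_mul_ε₁ : ε₂ * ε₁ = -(ε₁ * ε₂) := ι_mul_ι_swap _ _
theorem φ₂_mul_φ₁ : φ₂ * φ₁ = -(φ₁ * φ₂) := ι_mul_ι_swap _ _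
theorem φ₁_mul_ε₁ : φ₁ * ε₁ = -(ε₁ * φ₁) := ι_mul_ι_swap _ _
theorem φ₁_mul_ε₂ : φ₁ * ε₂ = -(ε₂ * φ₁) := ι_mul_ι_swap _ _
theorem φ₂_mul_ε₁ : φ₂ * ε₁ = -(ε₁ * φ₂) := ι_mul_ι_swap _ _
theorem φ₂_mul_ε₂ : φ₂ * ε₂ = -(ε₂ * φ₂) := ι_mul_ι_swap _ _

theorem ε₁_sq_assoc (x : Λ) : ε₁ * (ε₁ * x) = 0 := by rw [← mul_assoc, ε₁_sq, zero_mul]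
theorem ε₂_sq_assoc (x : Λ) : ε₂ * (ε₂ * x) = 0 := by rw [← mul_assoc, ε₂_sq, zero_mul]
theorem φ₁_sq_assoc (x : Λ) : φ₁ * (φ₁ * x) = 0 := by rw [← mul_assoc, φ₁_sq, zero_mul]
theorem ε₂_mul_ε₁_assoc (x : Λ) : ε₂ * (ε₁ * x) = -(ε₁ * (ε₂ * x)) := by
  rw [← mul_assoc, ε₂_mul_ε₁, neg_mul, mul_assoc]
theorem φ₂_mul_φ₁_assoc (x : Λ) : φ₂ * (φ₁ * x) = -(φ₁ * (φ₂ * x)) := by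
  rw [← mul_assoc, φ₂_mul_φ₁, neg_mul, mul_assoc]
theorem φ₁_mul_ε₁_assoc (x : Λ) : φ₁ * (ε₁ * x) = -(ε₁ * (φ₁ * x)) := by
  rw [← mul_assoc, φ₁_mul_ε₁, neg_mul, mul_assoc]
theorem φ₁_mul_ε₂_assoc (x : Λ) : φ₁ * (ε₂ * x) = -(ε₂ * (φ₁ * x)) := by
  rw [← mul_assoc, φ₁_mul_ε₂, neg_mul, mul_assoc]
theorem φ₂_mul_ε₁_assoc (x : Λ) : φ₂ * (ε₁ * x) = -(ε₁ * (φ₂ * x)) := by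
  rw [← mul_assoc, φ₂_mul_ε₁, neg_mul, mul_assoc]
theorem φ₂_mul_ε₂_assoc (x : Λ) : φ₂ * (ε₂ * x) = -(ε₂ * (φ₂ * x)) := by
  rw [← mul_assoc, φ₂_mul_ε₂, neg_mul, mul_assoc]

/-- The sixteen standard monomials of `⋀(𝔭)`. -/
def mon : Fin 16 → Λ :=
  ![1, ε₁, ε₂, φ₁, φ₂, ε₁ * ε₂, φ₁ * φ₂, ε₁ * φ₁, ε₁ * φ₂, ε₂ * φ₁, ε₂ * φ₂,
    ε₁ * (ε₂ * φ₁), ε₁ * (ε₂ * φ₂), ε₁ * (φ₁ * φ₂), ε₂ * (φ₁ * φ₂), ε₁ * (ε₂ * (φ₁ * φ₂))]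

/-! ### Coordinates on `𝔭` -/

theorem p_eq (X : 𝔭) : X =
    X.1.1 0 2 • (⟨E₁, Submodule.subset_span (by simp)⟩ : 𝔭) +
    X.1.1 1 2 • (⟨E₂, Submodule.subset_span (by simp)⟩ : 𝔭) +
    X.1.1 2 0 • (⟨F₁, Submodule.subset_span (by simp)⟩ : 𝔭) +
    X.1.1 2 1 • (⟨F₂, Submodule.subset_span (by simp)⟩ : 𝔭) := by
  obtain ⟨h1, h2, h3, h4, h5⟩ := (mem_p_iff X.1).mp X.2
  apply Subtype.ext
  apply Subtype.ext
  ext i j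
  fin_cases i <;> fin_cases j <;>
    simp [E₁, E₂, F₁, F₂, offDiag, unit, h1, h2, h3, h4, h5]

theorem ι_eq (X : 𝔭) : ExteriorAlgebra.ι ℂ X =
    X.1.1 0 2 • ε₁ + X.1.1 1 2 • ε₂ + X.1.1 2 0 • φ₁ + X.1.1 2 1 • φ₂ := by
  conv_lhs => rw [p_eq X]
  simp only [map_add, map_smul]
  rfl

/-- The coordinates on `𝔭` with respect to `E₁, E₂, F₁, F₂`. -/
def pEquiv : 𝔭 ≃ₗ[ℂ] (Fin 4 → ℂ) where
  toFun X := ![X.1.1 0 2, X.1.1 1 2, X.1.1 2 0, X.1.1 2 1]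
  invFun x :=
    x 0 • (⟨E₁, Submodule.subset_span (by simp)⟩ : 𝔭) +
    x 1 • (⟨E₂, Submodule.subset_span (by simp)⟩ : 𝔭) +
    x 2 • (⟨F₁, Submodule.subset_span (by simp)⟩ : 𝔭) +
    x 3 • (⟨F₂, Submodule.subset_span (by simp)⟩ : 𝔭)
  map_add' X Y := by ext i; fin_cases i <;> simp
  map_smul' c X := by ext i; fin_cases i <;> simp
  left_inv X := (p_eq X).symm
  right_inv x := by
    ext i; fin_cases i <;> simp [E₁, E₂, F₁, F₂, offDiag, unit]

theorem finrank_Λ : Module.finrank ℂ Λ = 16 := by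
  let b : Module.Basis (Fin 4) ℂ 𝔭 := Module.Basis.ofEquivFun pEquiv
  rw [Module.finrank_eq_card_basis b.ExteriorAlgebra]
  simp

/-- The span contains 1 and is stable under left multiplication by 𝔭, since the anticommutation
relations sort every product up to sign. As ⋀(𝔭) has dimension 16, spanning is all that a basis
requires. -/
theorem span_mon : ⊤ ≤ Submodule.span ℂ (Set.range mon) := by
  have hm : ∀ n, mon n ∈ Submodule.span ℂ (Set.range mon) := fun n =>
    Submodule.subset_span ⟨n, rfl⟩
  have hgen : ∀ X : 𝔭, ∀ y ∈ Submodule.span ℂ (Set.range mon),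
      ExteriorAlgebra.ι ℂ X * y ∈ Submodule.span ℂ (Set.range mon) := by
    intro X y hy
    induction hy using Submodule.span_induction with
    | zero => simp
    | add x y _ _ hx hy => rw [mul_add]; exact add_mem hx hy
    | smul c x _ hx => rw [mul_smul_comm]; exact Submodule.smul_mem _ _ hx
    | mem y hy =>
      obtain ⟨n, rfl⟩ := hy
      rw [ι_eq]
      simp only [add_mul, smul_mul_assoc]
      have := hm 0; have := hm 1; have := hm 2; have := hm 3; have := hm 4; have := hm 5
      have := hm 6; have := hm 7; have := hm 8; have := hm 9; have := hm 10; have := hm 11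
      have := hm 12; have := hm 13; have := hm 14; have := hm 15
      refine add_mem (add_mem (add_mem ?_ ?_) ?_) ?_ <;> refine Submodule.smul_mem _ _ ?_ <;>
      fin_cases n <;>
      simp only [mon, Fin.reduceFinMk, Matrix.cons_val] at * <;>
      (try simp only [mul_one, ε₁_sq, ε₂_sq, φ₁_sq, φ₂_sq, ε₂_mul_ε₁, φ₂_mul_φ₁, φ₁_mul_ε₁, φ₁_mul_ε₂,
        φ₂_mul_ε₁, φ₂_mul_ε₂, ε₁_sq_assoc, ε₂_sq_assoc, φ₁_sq_assoc,
        ε₂_mul_ε₁_assoc, φ₂_mul_φ₁_assoc, φ₁_mul_ε₁_assoc, φ₁_mul_ε₂_assoc, φ₂_mul_ε₁_assoc,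
        φ₂_mul_ε₂_assoc, mul_zero, mul_neg, neg_neg, neg_zero, neg_mem_iff, zero_mem]) <;>
      assumption
  rintro x -
  suffices H : ∀ y ∈ Submodule.span ℂ (Set.range mon),
      x * y ∈ Submodule.span ℂ (Set.range mon) by
    simpa using H 1 (hm 0)
  induction x using ExteriorAlgebra.induction with
  | algebraMap r =>
    intro y hy
    rw [← Algebra.smul_def]; exact Submodule.smul_mem _ _ hy
  | ι X => exact hgen X
  | mul x z hx hz => intro y hy; rw [mul_assoc]; exact hx _ (hz _ hy)
  | add x z hx hz => intro y hy; rw [add_mul]; exact add_mem (hx _ hy) (hz _ hy)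

/-- The standard monomials form a basis of `⋀(𝔭)`. -/
def monBasis : Module.Basis (Fin 16) ℂ Λ :=
  basisOfTopLeSpanOfCardEqFinrank mon span_mon (by rw [finrank_Λ]; rfl)

theorem coe_monBasis : (monBasis : Fin 16 → Λ) = mon :=
  coe_basisOfTopLeSpanOfCardEqFinrank _ _ _

/-! ### The action of `GL(2, ℂ)` -/

/-- The block diagonal matrix `diag(m, 1)`. -/
def blk (m : Matrix (Fin 2) (Fin 2) ℂ) : Matrix (Fin 3) (Fin 3) ℂ :=
  !![m 0 0, m 0 1, 0; m 1 0, m 1 1, 0; 0, 0, 1]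

theorem blk_mul (m n : Matrix (Fin 2) (Fin 2) ℂ) : blk (m * n) = blk m * blk n := by
  ext i j
  fin_cases i <;> fin_cases j <;>
    simp [blk, Matrix.mul_apply, Fin.sum_univ_succ]

theorem blk_one : blk 1 = 1 := by
  ext i j
  fin_cases i <;> fin_cases j <;> simp [blk]

theorem blk_inv_mul (u : GL (Fin 2) ℂ) : blk (u⁻¹).1 * blk u.1 = 1 := by
  rw [← blk_mul, ← Units.val_mul, inv_mul_cancel, Units.val_one, blk_one]

/-- Conjugation by `diag(u, 1)` on `𝔤`. -/
def AdG (u : GL (Fin 2) ℂ) : 𝔤 →ₗ[ℂ] 𝔤 where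
  toFun X := ⟨blk u.1 * X.1 * blk (u⁻¹).1, by
    rw [mem_g_iff, Matrix.trace_mul_comm, ← mul_assoc, blk_inv_mul, one_mul]
    exact X.2⟩
  map_add' X Y := Subtype.ext (by simp [mul_add, add_mul])
  map_smul' c X := Subtype.ext (by simp)

theorem AdG_coe (u : GL (Fin 2) ℂ) (X : 𝔤) : (AdG u X).1 = blk u.1 * X.1 * blk (u⁻¹).1 := rfl

theorem AdG_mul (u v : GL (Fin 2) ℂ) : AdG (u * v) = AdG u ∘ₗ AdG v := by
  ext1 X
  apply Subtype.ext
  simp only [AdG_coe, LinearMap.comp_apply, mul_inv_rev, Units.val_mul, blk_mul, mul_assoc]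

theorem AdG_one : AdG 1 = LinearMap.id := by
  ext1 X
  apply Subtype.ext
  simp [AdG_coe, blk_one]

theorem AdG_mem_p (u : GL (Fin 2) ℂ) (X : 𝔤) (hX : X ∈ 𝔭) : AdG u X ∈ 𝔭 := by
  rw [mem_p_iff] at hX ⊢
  obtain ⟨a1, a2, a3, a4, a5⟩ := hX
  simp only [AdG_coe, Matrix.mul_apply, Fin.sum_univ_three, a1, a2, a3, a4, a5]
  simp [blk]

/-- Conjugation by `diag(u, 1)` on `𝔭`. -/
def AdGp (u : GL (Fin 2) ℂ) : 𝔭 →ₗ[ℂ] 𝔭 := (AdG u).restrict (AdG_mem_p u)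

theorem AdGp_mul (u v : GL (Fin 2) ℂ) : AdGp (u * v) = AdGp u ∘ₗ AdGp v := by
  ext1 X
  apply Subtype.ext
  simp [AdGp, AdG_mul]

theorem AdGp_one : AdGp 1 = LinearMap.id := by
  ext1 X
  apply Subtype.ext
  simp [AdGp, AdG_one]

/-- The action of `GL(2, ℂ)` on `S(𝔤)`. -/
def actSG (u : GL (Fin 2) ℂ) : S →ₐ[ℂ] S := SymmetricAlgebra.lift (SymmetricAlgebra.ι ℂ 𝔤 ∘ₗ AdG u)

/-- The action of `GL(2, ℂ)` on `⋀(𝔭)`. -/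
def actΛG (u : GL (Fin 2) ℂ) : Λ →ₐ[ℂ] Λ := ExteriorAlgebra.map (AdGp u)

/-- The action of `GL(2, ℂ)` on `S(𝔤) ⊗ ⋀(𝔭)`. -/
def actG (u : GL (Fin 2) ℂ) : S ⊗[ℂ] Λ →ₐ[ℂ] S ⊗[ℂ] Λ :=
  Algebra.TensorProduct.map (actSG u) (actΛG u)

theorem actSG_ι (u : GL (Fin 2) ℂ) (X : 𝔤) : actSG u (s X) = s (AdG u X) := by
  simp [actSG]

theorem actSG_mul (u v : GL (Fin 2) ℂ) : actSG (u * v) = (actSG u).comp (actSG v) := by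
  apply SymmetricAlgebra.algHom_ext
  ext1 X
  simp [actSG, AdG_mul]

theorem actSG_one : actSG 1 = AlgHom.id ℂ S := by
  apply SymmetricAlgebra.algHom_ext
  ext1 X
  simp [actSG, AdG_one]

theorem actΛG_mul (u v : GL (Fin 2) ℂ) : actΛG (u * v) = (actΛG u).comp (actΛG v) := by
  rw [actΛG, AdGp_mul, ← ExteriorAlgebra.map_comp_map]; rfl

theorem actΛG_one : actΛG 1 = AlgHom.id ℂ Λ := by
  rw [actΛG, AdGp_one, ExteriorAlgebra.map_id]

theorem actG_mul (u v : GL (Fin 2) ℂ) : actG (u * v) = (actG u).comp (actG v) := by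
  rw [actG, actSG_mul, actΛG_mul, Algebra.TensorProduct.map_comp]; rfl

theorem actG_one : actG 1 = AlgHom.id ℂ (S ⊗[ℂ] Λ) := by
  rw [actG, actSG_one, actΛG_one, Algebra.TensorProduct.map_id]

/-- The stabilizer in `GL(2, ℂ)` of an element of `S(𝔤) ⊗ ⋀(𝔭)`. -/
def stab (x : S ⊗[ℂ] Λ) : Subgroup (GL (Fin 2) ℂ) where
  carrier := {u | actG u x = x}
  one_mem' := by simp [actG_one]
  mul_mem' := by
    intro u v hu hv
    simp only [Set.mem_ofPred_eq] at *
    rw [actG_mul, AlgHom.comp_apply, hv, hu]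
  inv_mem' := by
    intro u hu
    simp only [Set.mem_ofPred_eq] at *
    nth_rewrite 1 [← hu]
    rw [← AlgHom.comp_apply, ← actG_mul, inv_mul_cancel, actG_one, AlgHom.id_apply]

theorem mem_stab {x : S ⊗[ℂ] Λ} {u : GL (Fin 2) ℂ} : u ∈ stab x ↔ actG u x = x := Iff.rfl

/-- The scalar `c` cancels in the conjugation. -/
theorem Ad_eq_AdG (k : K) (u : GL (Fin 2) ℂ) (c : ℂ)
    (h : (k : Matrix.SpecialLinearGroup (Fin 3) ℂ).1 = c • blk u.1) : Ad k = AdG u := by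
  have hk : (k : Matrix.SpecialLinearGroup (Fin 3) ℂ).1 *
      ((k : Matrix.SpecialLinearGroup (Fin 3) ℂ)⁻¹).1 = 1 := by
    have := congrArg Subtype.val (mul_inv_cancel (k : Matrix.SpecialLinearGroup (Fin 3) ℂ))
    simpa only [Matrix.SpecialLinearGroup.coe_mul, Matrix.SpecialLinearGroup.coe_one] using this
  have hinv : c • ((k : Matrix.SpecialLinearGroup (Fin 3) ℂ)⁻¹).1 = blk (u⁻¹).1 := by
    rw [h] at hk
    calc c • ((k : Matrix.SpecialLinearGroup (Fin 3) ℂ)⁻¹).1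
        = (blk (u⁻¹).1 * blk u.1) * c • ((k : Matrix.SpecialLinearGroup (Fin 3) ℂ)⁻¹).1 := by
          rw [blk_inv_mul, one_mul]
      _ = blk (u⁻¹).1 * ((c • blk u.1) * ((k : Matrix.SpecialLinearGroup (Fin 3) ℂ)⁻¹).1) := by
          rw [mul_smul_comm, smul_mul_assoc, mul_smul_comm, mul_assoc]
      _ = blk (u⁻¹).1 := by rw [hk, mul_one]
  ext1 X
  apply Subtype.ext
  rw [AdG_coe, ← hinv]
  simp only [Ad, LinearMap.coe_mk, AddHom.coe_mk]
  rw [h]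
  simp only [smul_mul_assoc, mul_smul_comm]

theorem act_eq_actG (k : K) (u : GL (Fin 2) ℂ) (c : ℂ)
    (h : (k : Matrix.SpecialLinearGroup (Fin 3) ℂ).1 = c • blk u.1) : act k = actG u := by
  have h1 := Ad_eq_AdG k u c h
  have h2 : Adp k = AdGp u := by
    ext1 X
    apply Subtype.ext
    simp [Adp, AdGp, h1]
  simp only [act, actG, actS, actSG, actΛ, actΛG, h1, h2]

/-- The determinant condition forces the lower right entry of `k` to be nonzero; dividing by it
gives diag(u, 1). -/
theorem exists_act_eq_actG (k : K) : ∃ u : GL (Fin 2) ℂ, act k = actG u := by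
  obtain ⟨hu, h1, h2, h3, h4⟩ := k.2
  set M := (k : Matrix.SpecialLinearGroup (Fin 3) ℂ).1 with hM
  have hdet : M.det = 1 := (k : Matrix.SpecialLinearGroup (Fin 3) ℂ).2
  change M 0 2 = 0 at h1
  change M 1 2 = 0 at h2
  change M 2 0 = 0 at h3
  change M 2 1 = 0 at h4
  rw [Matrix.det_fin_three, h1, h2, h3, h4] at hdet
  have hdet' : (M 0 0 * M 1 1 - M 0 1 * M 1 0) * M 2 2 = 1 := by linear_combination hdet
  have h22 : M 2 2 ≠ 0 := right_ne_zero_of_mul_eq_one hdet'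
  have hd : M 0 0 * M 1 1 - M 0 1 * M 1 0 ≠ 0 := left_ne_zero_of_mul_eq_one hdet'
  let m : Matrix (Fin 2) (Fin 2) ℂ := (M 2 2)⁻¹ • !![M 0 0, M 0 1; M 1 0, M 1 1]
  have hm : m.det ≠ 0 := by
    simp only [m, Matrix.det_smul, Matrix.det_fin_two_of]
    simp [h22, hd]
  refine ⟨Matrix.GeneralLinearGroup.mkOfDetNeZero m hm, act_eq_actG k _ (M 2 2) ?_⟩
  rw [← hM]
  ext i j
  fin_cases i <;> fin_cases j <;>
    simp [blk, Matrix.GeneralLinearGroup.mkOfDetNeZero, m, h1, h2, h3, h4, h22]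

/-! ### Values on generators -/

theorem g_eq (X : 𝔤) : X =
    (3 / 2 * (X.1 0 0 + X.1 1 1)) • (H₁ + H₂) + ((X.1 0 0 - X.1 1 1) / 2) • H +
    X.1 0 1 • E + X.1 1 0 • F + X.1 0 2 • E₁ + X.1 1 2 • E₂ + X.1 2 0 • F₁ + X.1 2 1 • F₂ := by
  have h := (mem_g_iff X.1).mp X.2
  rw [Matrix.trace_fin_three] at h
  apply Subtype.ext
  ext i j
  fin_cases i <;> fin_cases j <;>
    simp [H, H₁, H₂, E, F, E₁, E₂, F₁, F₂, offDiag, unit]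
  · ring
  · ring
  · linear_combination h

/-- The coordinates on `𝔤`. -/
def gEquiv : 𝔤 ≃ₗ[ℂ] (Fin 8 → ℂ) where
  toFun X := ![3 / 2 * (X.1 0 0 + X.1 1 1), (X.1 0 0 - X.1 1 1) / 2, X.1 0 1, X.1 1 0,
    X.1 0 2, X.1 1 2, X.1 2 0, X.1 2 1]
  invFun x := x 0 • (H₁ + H₂) + x 1 • H + x 2 • E + x 3 • F + x 4 • E₁ + x 5 • E₂ +
    x 6 • F₁ + x 7 • F₂
  map_add' X Y := by ext i; fin_cases i <;> simp <;> ring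
  map_smul' c X := by ext i; fin_cases i <;> simp <;> ring
  left_inv X := (g_eq X).symm
  right_inv x := by
    ext i; fin_cases i <;> simp [H, H₁, H₂, E, F, E₁, E₂, F₁, F₂, offDiag, unit] <;> ring

theorem S_hom_ext {A : Type*} [CommRing A] [Algebra ℂ A] {p q : S →ₐ[ℂ] A}
    (h0 : p (s (H₁ + H₂)) = q (s (H₁ + H₂))) (h1 : p (s H) = q (s H)) (h2 : p (s E) = q (s E))
    (h3 : p (s F) = q (s F)) (h4 : p (s E₁) = q (s E₁)) (h5 : p (s E₂) = q (s E₂))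
    (h6 : p (s F₁) = q (s F₁)) (h7 : p (s F₂) = q (s F₂)) : p = q := by
  apply SymmetricAlgebra.algHom_ext
  ext1 X
  change p (s X) = q (s X)
  obtain ⟨c, hX⟩ : ∃ c : Fin 8 → ℂ, X = c 0 • (H₁ + H₂) + c 1 • H + c 2 • E + c 3 • F +
      c 4 • E₁ + c 5 • E₂ + c 6 • F₁ + c 7 • F₂ := ⟨gEquiv X, g_eq X⟩
  rw [hX]
  simp only [map_add, map_smul] at *
  simp only [h0, h1, h2, h3, h4, h5, h6, h7]

/-- Evaluation of elements of `S(𝔤)` at the linear form `X ↦ tr (Y X)` on `𝔤`. -/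
def pt {A : Type*} [CommRing A] [Algebra ℂ A] (Y : Matrix (Fin 3) (Fin 3) A) : S →ₐ[ℂ] A :=
  SymmetricAlgebra.lift
    { toFun := fun X => (Y * X.1.map (algebraMap ℂ A)).trace
      map_add' := fun X X' => by
        rw [show (X + X').1 = X.1 + X'.1 from rfl, Matrix.map_add _ (map_add _), mul_add, Matrix.trace_add]
      map_smul' := fun c X => by
        have : (c • X.1).map (algebraMap ℂ A) = c • X.1.map (algebraMap ℂ A) := by
          ext i j
          rw [Matrix.map_apply, Matrix.smul_apply, Matrix.smul_apply, Matrix.map_apply,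
            smul_eq_mul, map_mul, Algebra.smul_def]
        rw [show (c • X).1 = c • X.1 from rfl, this, mul_smul_comm, Matrix.trace_smul, RingHom.id_apply] }

section pt
variable {A : Type*} [CommRing A] [Algebra ℂ A] (Y : Matrix (Fin 3) (Fin 3) A)

theorem pt_ι (X : 𝔤) : pt Y (s X) = (Y * X.1.map (algebraMap ℂ A)).trace := by
  simp [pt]

theorem pt_a : 3 * pt Y (s (H₁ + H₂)) = Y 0 0 + Y 1 1 - 2 * Y 2 2 := by
  have h : (3 : A) * algebraMap ℂ A (1 / 3) = 1 := by
    rw [← map_ofNat (algebraMap ℂ A) 3, ← map_mul]; norm_num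
  have h2 : algebraMap ℂ A 2 = 2 := map_ofNat _ 2
  rw [pt_ι]
  simp [Matrix.trace_fin_three, Matrix.mul_apply, Fin.sum_univ_three, H₁, H₂, unit, h2] at h ⊢
  linear_combination (Y 0 0 + Y 1 1 - 2 * Y 2 2) * h

@[simp] theorem pt_H : pt Y (s H) = Y 0 0 - Y 1 1 := by
  have h : (3 : A) * algebraMap ℂ A (1 / 3) = 1 := by
    rw [← map_ofNat (algebraMap ℂ A) 3, ← map_mul]; norm_num
  have h2 : algebraMap ℂ A 2 = 2 := map_ofNat _ 2
  rw [pt_ι]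
  simp [Matrix.trace_fin_three, Matrix.mul_apply, Fin.sum_univ_three, H, H₁, H₂, unit, h2] at h ⊢
  linear_combination (Y 0 0 - Y 1 1) * h

@[simp] theorem pt_E : pt Y (s E) = Y 1 0 := by
  rw [pt_ι]
  simp [Matrix.trace_fin_three, Matrix.mul_apply, Fin.sum_univ_three, E, offDiag, unit]

@[simp] theorem pt_F : pt Y (s F) = Y 0 1 := by
  rw [pt_ι]
  simp [Matrix.trace_fin_three, Matrix.mul_apply, Fin.sum_univ_three, F, offDiag, unit]

@[simp] theorem pt_E₁ : pt Y (s E₁) = Y 2 0 := by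
  rw [pt_ι]
  simp [Matrix.trace_fin_three, Matrix.mul_apply, Fin.sum_univ_three, E₁, offDiag, unit]

@[simp] theorem pt_E₂ : pt Y (s E₂) = Y 2 1 := by
  rw [pt_ι]
  simp [Matrix.trace_fin_three, Matrix.mul_apply, Fin.sum_univ_three, E₂, offDiag, unit]

@[simp] theorem pt_F₁ : pt Y (s F₁) = Y 0 2 := by
  rw [pt_ι]
  simp [Matrix.trace_fin_three, Matrix.mul_apply, Fin.sum_univ_three, F₁, offDiag, unit]

@[simp] theorem pt_F₂ : pt Y (s F₂) = Y 1 2 := by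
  rw [pt_ι]
  simp [Matrix.trace_fin_three, Matrix.mul_apply, Fin.sum_univ_three, F₂, offDiag, unit]

end pt

theorem pt_actSG (Y : Matrix (Fin 3) (Fin 3) ℂ) (u : GL (Fin 2) ℂ) (x : S) :
    pt Y (actSG u x) = pt (blk (u⁻¹).1 * Y * blk u.1) x := by
  suffices (pt Y).comp (actSG u) = pt (blk (u⁻¹).1 * Y * blk u.1) from
    DFunLike.congr_fun this x
  apply SymmetricAlgebra.algHom_ext
  ext1 X
  change pt Y (actSG u (s X)) = pt _ (s X)
  rw [actSG_ι, pt_ι, pt_ι, AdG_coe]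
  have : ∀ M : Matrix (Fin 3) (Fin 3) ℂ, M.map (algebraMap ℂ ℂ) = M := fun M => by ext; simp
  rw [this, this, ← mul_assoc, Matrix.trace_mul_comm, ← mul_assoc, ← mul_assoc]

/-- The form tr(Y ·) on traceless matrices depends only on Y modulo scalars, so the lower right
entry may be taken to be 0; the other two diagonal entries are then solved for from the values at H₁
+ H₂ and H. -/
theorem exists_eq_pt (p : S →ₐ[ℂ] ℂ) : ∃ Y, p = pt Y := by
  refine ⟨!![(3 * p (s (H₁ + H₂)) + p (s H)) / 2, p (s F), p (s F₁);
    p (s E), (3 * p (s (H₁ + H₂)) - p (s H)) / 2, p (s F₂); p (s E₁), p (s E₂), 0], ?_⟩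
  apply S_hom_ext
  · apply mul_left_cancel₀ (three_ne_zero' ℂ)
    rw [pt_a]; simp; ring
  · simp; ring
  all_goals simp

theorem eq_zero_of_pt {x : S} (h : ∀ Y : Matrix (Fin 3) (Fin 3) ℂ, pt Y x = 0) : x = 0 := by
  let b : Module.Basis (Fin 8) ℂ 𝔤 := Module.Basis.ofEquivFun gEquiv
  apply (SymmetricAlgebra.equivMvPolynomial b).injective
  rw [map_zero]
  apply MvPolynomial.funext
  intro v
  obtain ⟨Y, hY⟩ := exists_eq_pt
    ((MvPolynomial.aeval v).comp (SymmetricAlgebra.equivMvPolynomial b).toAlgHom)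
  have := h Y
  rw [← hY] at this
  simpa using this

/-- Density of a nonempty principal open set: S(𝔤) is a domain, and q(x − y) vanishes at every
point. This is how formulas proved in a moving frame become identities in S(𝔤). -/
theorem eq_of_pt {x y q : S} (hq : q ≠ 0)
    (h : ∀ Y : Matrix (Fin 3) (Fin 3) ℂ, pt Y q ≠ 0 → pt Y x = pt Y y) : x = y := by
  have : q * (x - y) = 0 := by
    apply eq_zero_of_pt
    intro Y
    rw [map_mul, map_sub]
    by_cases hY : pt Y q = 0
    · rw [hY, zero_mul]
    · rw [h Y hY, sub_self, mul_zero]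
  exact sub_eq_zero.mp ((mul_eq_zero.mp this).resolve_left hq)

/-! ### Coefficients -/

/-- Evaluation of the `S(𝔤)`-factor. -/
def ev (Y : Matrix (Fin 3) (Fin 3) ℂ) : S ⊗[ℂ] Λ →ₐ[ℂ] Λ :=
  Algebra.TensorProduct.lift ((Algebra.ofId ℂ Λ).comp (pt Y)) (AlgHom.id ℂ Λ)
    (fun p l => Algebra.commutes (pt Y p) l)

theorem ev_tmul (Y : Matrix (Fin 3) (Fin 3) ℂ) (p : S) (l : Λ) : ev Y (p ⊗ₜ l) = pt Y p • l := by
  rw [Algebra.smul_def]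
  exact Algebra.TensorProduct.lift_tmul _ _ _ _ _

theorem ev_actG (Y : Matrix (Fin 3) (Fin 3) ℂ) (u : GL (Fin 2) ℂ) (x : S ⊗[ℂ] Λ) :
    ev Y (actG u x) = actΛG u (ev (blk (u⁻¹).1 * Y * blk u.1) x) := by
  induction x using TensorProduct.induction_on with
  | zero => simp
  | tmul p l => simp [actG, ev_tmul, pt_actSG]
  | add x y hx hy => simp only [map_add, hx, hy]

/-- The `S(𝔤)`-basis of `S(𝔤) ⊗ ⋀(𝔭)` given by the standard monomials. -/
def SBasis : Module.Basis (Fin 16) S (S ⊗[ℂ] Λ) := Algebra.TensorProduct.basis S monBasis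

/-- The coefficients of an element of `S(𝔤) ⊗ ⋀(𝔭)` in the standard monomials. -/
def cf (x : S ⊗[ℂ] Λ) (n : Fin 16) : S := SBasis.repr x n

theorem repr_ev (Y : Matrix (Fin 3) (Fin 3) ℂ) (x : S ⊗[ℂ] Λ) (n : Fin 16) :
    monBasis.repr (ev Y x) n = pt Y (cf x n) := by
  induction x using TensorProduct.induction_on with
  | zero => simp [cf]
  | tmul p l =>
    simp [cf, SBasis, ev_tmul, Algebra.TensorProduct.basis_repr_tmul, mul_comm]
  | add x y hx hy =>
    simp only [map_add, Finsupp.add_apply, hx, hy, cf]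

theorem eq_of_ev {x y : S ⊗[ℂ] Λ} (h : ∀ Y, ev Y x = ev Y y) : x = y := by
  apply SBasis.repr.injective
  ext n
  refine eq_of_pt (q := 1) one_ne_zero fun Y _ => ?_
  have := congrArg (fun l => monBasis.repr l n) (h Y)
  simpa only [repr_ev, cf] using this

/-! ### From `K`-invariance to `GL(2, ℂ)`-invariance -/

/-- If a one-parameter family of algebra endomorphisms acts with integral weights on a generating
set, then an element fixed by one member of infinite order is fixed by the whole family. -/
theorem fixed_of_weights {A : Type*} [Ring A] [Algebra ℂ A] (D : ℂˣ → A →ₐ[ℂ] A) (G : Set A)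
    (hG : Algebra.adjoin ℂ G = ⊤) (hw : ∀ y ∈ G, ∃ n : ℤ, ∀ t, D t y = ((t ^ n : ℂˣ) : ℂ) • y)
    (z : ℂˣ) (hz : ∀ n : ℤ, z ^ n = 1 → n = 0) (x : A) (hx : D z x = x) (t : ℂˣ) : D t x = x := by
  let V : ℤ → Submodule ℂ A := fun n =>
    ⨅ t, LinearMap.eqLocus (D t).toLinearMap (((t ^ n : ℂˣ) : ℂ) • LinearMap.id)
  have hV : ∀ n y, y ∈ V n ↔ ∀ t, D t y = ((t ^ n : ℂˣ) : ℂ) • y := by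
    intro n y
    simp [V, Submodule.mem_iInf, LinearMap.mem_eqLocus]
  let M : Submonoid A :=
    { carrier := {y | ∃ n : ℤ, ∀ t, D t y = ((t ^ n : ℂˣ) : ℂ) • y}
      one_mem' := ⟨0, by simp⟩
      mul_mem' := by
        rintro y y' ⟨n, hn⟩ ⟨n', hn'⟩
        refine ⟨n + n', fun t => ?_⟩
        rw [map_mul, hn, hn', smul_mul_smul_comm, zpow_add, Units.val_mul] }
  have hspan : x ∈ ⨆ n, V n := by
    have h1 : x ∈ Algebra.adjoin ℂ (M : Set A) :=
      Algebra.adjoin_mono (show G ⊆ M from hw) (hG ▸ Algebra.mem_top)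
    rw [← Subalgebra.mem_toSubmodule, Algebra.adjoin_eq_span, Submonoid.closure_eq] at h1
    refine (Submodule.span_le.mpr ?_) h1
    rintro y ⟨n, hn⟩
    exact Submodule.mem_iSup_of_mem n ((hV n y).mpr hn)
  obtain ⟨y, hy, rfl⟩ := (Submodule.mem_iSup_iff_exists_finsupp _ _).mp hspan
  have hind : iSupIndep V := by
    have hinj : Function.Injective (fun n : ℤ => ((z ^ n : ℂˣ) : ℂ)) := by
      intro n m hnm
      have h1 : z ^ n = z ^ m := Units.ext hnm
      have h2 : z ^ (n - m) = 1 := by rw [zpow_sub, h1, mul_inv_cancel]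
      exact sub_eq_zero.mp (hz _ h2)
    refine ((Module.End.eigenspaces_iSupIndep (D z).toLinearMap).comp hinj).mono ?_
    intro n v hv
    exact Module.End.mem_eigenspace_iff.mpr ((hV n v).mp hv z)
  -- Applying D z − 1 to the weight decomposition gives 0, and it multiplies the component of weight
  -- n by zⁿ − 1; independence kills each term separately.
  have hzero : ∀ n ∈ y.support, (((z ^ n : ℂˣ) : ℂ) - 1) • y n = 0 := by
    refine (iSupIndep_iff_finsetSum_eq_zero_imp_eq_zero V).mp hind _ _
      (fun n _ => Submodule.smul_mem _ _ (hy n)) ?_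
    simp only [Finsupp.sum, map_sum, fun n => (hV n _).mp (hy n)] at hx
    simp only [sub_smul, one_smul, Finset.sum_sub_distrib, hx, sub_self]
  simp only [Finsupp.sum, map_sum]
  refine Finset.sum_congr rfl fun n hn => ?_
  rw [(hV n _).mp (hy n)]
  rcases smul_eq_zero.mp (hzero n hn) with h | h
  · have : z ^ n = 1 := Units.ext (by simpa using sub_eq_zero.mp h)
    rw [hz n this]; simp
  · rw [h, smul_zero]

/-- The diagonal matrix `diag(t, 1)`. -/
def tor (t : ℂˣ) : GL (Fin 2) ℂ where
  val := !![(t : ℂ), 0; 0, 1]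
  inv := !![((t⁻¹ : ℂˣ) : ℂ), 0; 0, 1]
  val_inv := by ext i j; fin_cases i <;> fin_cases j <;> simp
  inv_val := by ext i j; fin_cases i <;> fin_cases j <;> simp

/-- The rotation matrix with cosine `p` and sine `q`. -/
def rot (p q : ℂ) (h : p ^ 2 + q ^ 2 = 1) : GL (Fin 2) ℂ where
  val := !![p, -q; q, p]
  inv := !![p, q; -q, p]
  val_inv := by
    ext i j
    fin_cases i <;> fin_cases j <;> simp <;> first | linear_combination h | ring
  inv_val := by
    ext i j
    fin_cases i <;> fin_cases j <;> simp <;> first | linear_combination h | ring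

theorem tor_inv_val (t : ℂˣ) : ((tor t)⁻¹).1 = !![((t⁻¹ : ℂˣ) : ℂ), 0; 0, 1] := rfl

theorem tor_val (t : ℂˣ) : (tor t).1 = !![(t : ℂ), 0; 0, 1] := rfl

theorem rot_val (p q : ℂ) (h : p ^ 2 + q ^ 2 = 1) : (rot p q h).1 = !![p, -q; q, p] := rfl

/-- A subgroup of `GL(2, ℂ)` that contains the tori `diag(t, 1)` and the real rotations is
everything. -/
theorem eq_top_of_tor_rot (G : Subgroup (GL (Fin 2) ℂ)) (ht : ∀ t, tor t ∈ G)
    (hr : ∀ (p q : ℝ) (h : (p : ℂ) ^ 2 + (q : ℂ) ^ 2 = 1), rot p q h ∈ G) : G = ⊤ := by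
  have hr' : ∀ (p q : ℝ), p ^ 2 + q ^ 2 = 1 → ∃ v ∈ G, v.1 = !![(p : ℂ), -q; q, p] := fun p q h =>
    ⟨rot p q (by exact_mod_cast h), hr _ _ _, rfl⟩
  obtain ⟨w, hw, hwv⟩ := hr' 0 1 (by norm_num)
  obtain ⟨w', hw', hwv'⟩ := hr' 0 (-1) (by norm_num)
  have hdiag : ∀ p q : ℂ, p ≠ 0 → q ≠ 0 → ∃ v ∈ G, v.1 = !![p, 0; 0, q] := by
    intro p q hp hq
    refine ⟨tor (Units.mk0 p hp) * (w * tor (Units.mk0 q hq) * w'),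
      mul_mem (ht _) (mul_mem (mul_mem hw (ht _)) hw'), ?_⟩
    simp only [Units.val_mul, hwv, hwv', tor_val]
    ext i j
    fin_cases i <;> fin_cases j <;> simp
  -- A singular value decomposition of a unipotent matrix with rational factors: the rotations come
  -- from the 3-4-5 triangle and the singular values are 3/4 and 4/3.
  have hup0 : ∃ v ∈ G, v.1 = !![(1 : ℂ), -7 / 12; 0, 1] := by
    obtain ⟨r, hrG, hrv⟩ := hr' (3 / 5) (4 / 5) (by norm_num)
    obtain ⟨r', hrG', hrv'⟩ := hr' (4 / 5) (-3 / 5) (by norm_num)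
    obtain ⟨v, hv, hvv⟩ := hdiag (3 / 4) (4 / 3) (by norm_num) (by norm_num)
    refine ⟨r * v * r', mul_mem (mul_mem hrG hv) hrG', ?_⟩
    simp only [Units.val_mul, hrv, hrv', hvv]
    ext i j
    fin_cases i <;> fin_cases j <;> simp <;> norm_num
  have hup : ∀ p : ℂ, ∃ v ∈ G, v.1 = !![1, p; 0, 1] := by
    intro p
    by_cases hp : p = 0
    · refine ⟨1, one_mem _, ?_⟩
      ext i j
      fin_cases i <;> fin_cases j <;> simp [hp]
    obtain ⟨v, hv, hvv⟩ := hup0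
    -- Conjugation by diag(r, 1) multiplies the upper right entry by r; the factor −12/7 normalises
    -- −7/12 to 1.
    obtain ⟨t, htG, htv⟩ := hdiag (-12 / 7 * p) 1 (by simp [hp]) one_ne_zero
    obtain ⟨t', htG', htv'⟩ := hdiag (-12 / 7 * p)⁻¹ 1 (by simp [hp]) one_ne_zero
    refine ⟨t * v * t', mul_mem (mul_mem htG hv) htG', ?_⟩
    simp only [Units.val_mul, hvv, htv, htv']
    ext i j
    fin_cases i <;> fin_cases j <;> simp <;> field_simp
  have hlow : ∀ p : ℂ, ∃ v ∈ G, v.1 = !![1, 0; p, 1] := by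
    intro p
    obtain ⟨v, hv, hvv⟩ := hup (-p)
    refine ⟨w * v * w', mul_mem (mul_mem hw hv) hw', ?_⟩
    simp only [Units.val_mul, hvv, hwv, hwv']
    ext i j
    fin_cases i <;> fin_cases j <;> simp
  have hgen : ∀ u : GL (Fin 2) ℂ, u.1 0 0 ≠ 0 → u ∈ G := by
    intro u hu
    have hdet : u.1 0 0 * u.1 1 1 - u.1 0 1 * u.1 1 0 ≠ 0 := by
      rw [← Matrix.det_fin_two]
      exact (Matrix.isUnit_iff_isUnit_det _).mp u.isUnit |>.ne_zero
    obtain ⟨v1, h1, h1v⟩ := hlow (u.1 1 0 / u.1 0 0)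
    obtain ⟨v2, h2, h2v⟩ := hdiag (u.1 0 0)
      ((u.1 0 0 * u.1 1 1 - u.1 0 1 * u.1 1 0) / u.1 0 0) hu (div_ne_zero hdet hu)
    -- Together with `v1` and `v2` this is the LDU factorisation, available because the upper left
    -- entry is nonzero.
    obtain ⟨v3, h3, h3v⟩ := hup (u.1 0 1 / u.1 0 0)
    have : u = v1 * v2 * v3 := by
      apply Units.ext
      simp only [Units.val_mul, h1v, h2v, h3v]
      ext i j
      fin_cases i <;> fin_cases j <;> simp <;> field_simp
      ring
    rw [this]
    exact mul_mem (mul_mem h1 h2) h3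
  rw [eq_top_iff]
  rintro u -
  by_cases hu : u.1 0 0 = 0
  · have hdet : u.1 0 0 * u.1 1 1 - u.1 0 1 * u.1 1 0 ≠ 0 := by
      rw [← Matrix.det_fin_two]
      exact (Matrix.isUnit_iff_isUnit_det _).mp u.isUnit |>.ne_zero
    have h10 : u.1 1 0 ≠ 0 := by
      intro h; apply hdet; rw [hu, h]; ring
    -- The quarter turn `w` exchanges the rows up to sign and so moves the nonzero entry to the
    -- corner.
    refine (Subgroup.mul_mem_cancel_left G hw).mp (hgen _ ?_)
    rw [Units.val_mul, hwv, Matrix.mul_apply, Fin.sum_univ_two]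
    simpa using h10
  · exact hgen u hu

/-- The weight vectors for `diag(t, 1)` that generate `S(𝔤) ⊗ ⋀(𝔭)`. -/
def gens : Set (S ⊗[ℂ] Λ) :=
  {s (H₁ + H₂) ⊗ₜ 1, s H ⊗ₜ 1, s E ⊗ₜ 1, s F ⊗ₜ 1, s E₁ ⊗ₜ 1, s E₂ ⊗ₜ 1, s F₁ ⊗ₜ 1, s F₂ ⊗ₜ 1,
    1 ⊗ₜ ε₁, 1 ⊗ₜ ε₂, 1 ⊗ₜ φ₁, 1 ⊗ₜ φ₂}

theorem adjoin_gens : Algebra.adjoin ℂ gens = ⊤ := by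
  have hS : ∀ p : S, p ⊗ₜ[ℂ] (1 : Λ) ∈ Algebra.adjoin ℂ gens := by
    intro p
    change p ∈ (Algebra.adjoin ℂ gens).comap
      (Algebra.TensorProduct.includeLeft : S →ₐ[ℂ] S ⊗[ℂ] Λ)
    induction p using SymmetricAlgebra.induction with
    | algebraMap r => exact algebraMap_mem _ r
    | ι X =>
      obtain ⟨c, hX⟩ : ∃ c : Fin 8 → ℂ, X = c 0 • (H₁ + H₂) + c 1 • H + c 2 • E + c 3 • F +
          c 4 • E₁ + c 5 • E₂ + c 6 • F₁ + c 7 • F₂ := ⟨gEquiv X, g_eq X⟩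
      rw [hX]
      simp only [map_add, map_smul]
      rw [← map_add]
      refine add_mem (add_mem (add_mem (add_mem (add_mem (add_mem (add_mem ?_ ?_) ?_) ?_) ?_) ?_)
        ?_) ?_ <;> refine Subalgebra.smul_mem _ ?_ _ <;> rw [Subalgebra.mem_comap] <;>
        exact Algebra.subset_adjoin (by simp [gens])
    | mul p q hp hq => exact mul_mem hp hq
    | add p q hp hq => exact add_mem hp hq
  have hΛ : ∀ l : Λ, (1 : S) ⊗ₜ[ℂ] l ∈ Algebra.adjoin ℂ gens := by
    intro l
    change l ∈ (Algebra.adjoin ℂ gens).comap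
      (Algebra.TensorProduct.includeRight : Λ →ₐ[ℂ] S ⊗[ℂ] Λ)
    induction l using ExteriorAlgebra.induction with
    | algebraMap r => exact algebraMap_mem _ r
    | ι X =>
      rw [ι_eq]
      refine add_mem (add_mem (add_mem ?_ ?_) ?_) ?_ <;> refine Subalgebra.smul_mem _ ?_ _ <;>
        rw [Subalgebra.mem_comap] <;>
        exact Algebra.subset_adjoin (by simp [gens])
    | mul p q hp hq => exact mul_mem hp hq
    | add p q hp hq => exact add_mem hp hq
  rw [eq_top_iff]
  rintro x -
  induction x using TensorProduct.induction_on with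
  | zero => exact zero_mem _
  | tmul p l =>
    have := mul_mem (hS p) (hΛ l)
    rwa [Algebra.TensorProduct.tmul_mul_tmul, mul_one, one_mul] at this
  | add x y hx hy => exact add_mem hx hy

/-! ### Explicit conjugation formulas and torus weights -/

section AdG
variable (u : GL (Fin 2) ℂ)

theorem AdG_E₁ : AdG u E₁ = u.1 0 0 • E₁ + u.1 1 0 • E₂ := by
  apply Subtype.ext
  rw [AdG_coe]
  ext i j
  simp only [Matrix.mul_apply, Fin.sum_univ_three]
  fin_cases i <;> fin_cases j <;> simp [blk, E₁, E₂, offDiag, unit]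

theorem AdG_E₂ : AdG u E₂ = u.1 0 1 • E₁ + u.1 1 1 • E₂ := by
  apply Subtype.ext
  rw [AdG_coe]
  ext i j
  simp only [Matrix.mul_apply, Fin.sum_univ_three]
  fin_cases i <;> fin_cases j <;> simp [blk, E₁, E₂, offDiag, unit]

theorem AdG_F₁ : AdG u F₁ = (u⁻¹).1 0 0 • F₁ + (u⁻¹).1 0 1 • F₂ := by
  apply Subtype.ext
  rw [AdG_coe]
  ext i j
  simp only [Matrix.mul_apply, Fin.sum_univ_three]
  fin_cases i <;> fin_cases j <;> simp [blk, F₁, F₂, offDiag, unit]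

theorem AdG_F₂ : AdG u F₂ = (u⁻¹).1 1 0 • F₁ + (u⁻¹).1 1 1 • F₂ := by
  apply Subtype.ext
  rw [AdG_coe]
  ext i j
  simp only [Matrix.mul_apply, Fin.sum_univ_three]
  fin_cases i <;> fin_cases j <;> simp [blk, F₁, F₂, offDiag, unit]

theorem actΛG_ε₁ : actΛG u ε₁ = u.1 0 0 • ε₁ + u.1 1 0 • ε₂ := by
  rw [actΛG, ε₁, ExteriorAlgebra.map_apply_ι, ε₂, ← map_smul, ← map_smul, ← map_add]
  congr 1
  exact Subtype.ext (AdG_E₁ u)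

theorem actΛG_ε₂ : actΛG u ε₂ = u.1 0 1 • ε₁ + u.1 1 1 • ε₂ := by
  rw [actΛG, ε₁, ε₂, ExteriorAlgebra.map_apply_ι, ← map_smul, ← map_smul, ← map_add]
  congr 1
  exact Subtype.ext (AdG_E₂ u)

theorem actΛG_φ₁ : actΛG u φ₁ = (u⁻¹).1 0 0 • φ₁ + (u⁻¹).1 0 1 • φ₂ := by
  rw [actΛG, φ₁, ExteriorAlgebra.map_apply_ι, φ₂, ← map_smul, ← map_smul, ← map_add]
  congr 1
  exact Subtype.ext (AdG_F₁ u)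

theorem actΛG_φ₂ : actΛG u φ₂ = (u⁻¹).1 1 0 • φ₁ + (u⁻¹).1 1 1 • φ₂ := by
  rw [actΛG, φ₁, φ₂, ExteriorAlgebra.map_apply_ι, ← map_smul, ← map_smul, ← map_add]
  congr 1
  exact Subtype.ext (AdG_F₂ u)

end AdG

theorem AdG_tor_H₁ (t : ℂˣ) : AdG (tor t) H₁ = H₁ := by
  apply Subtype.ext
  rw [AdG_coe, tor_inv_val, tor_val]
  ext i j
  simp only [Matrix.mul_apply, Fin.sum_univ_three]
  fin_cases i <;> fin_cases j <;> simp [blk, H₁, unit, mul_right_comm]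

theorem AdG_tor_H₂ (t : ℂˣ) : AdG (tor t) H₂ = H₂ := by
  apply Subtype.ext
  rw [AdG_coe, tor_inv_val, tor_val]
  ext i j
  simp only [Matrix.mul_apply, Fin.sum_univ_three]
  fin_cases i <;> fin_cases j <;> simp [blk, H₂, unit, mul_right_comm]

theorem AdG_tor_E (t : ℂˣ) : AdG (tor t) E = (t : ℂ) • E := by
  apply Subtype.ext
  rw [AdG_coe, tor_inv_val, tor_val]
  ext i j
  simp only [Matrix.mul_apply, Fin.sum_univ_three]
  fin_cases i <;> fin_cases j <;> simp [blk, E, offDiag, unit]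

theorem AdG_tor_F (t : ℂˣ) : AdG (tor t) F = ((t⁻¹ : ℂˣ) : ℂ) • F := by
  apply Subtype.ext
  rw [AdG_coe, tor_inv_val, tor_val]
  ext i j
  simp only [Matrix.mul_apply, Fin.sum_univ_three]
  fin_cases i <;> fin_cases j <;> simp [blk, F, offDiag, unit]

theorem gens_weight (y : S ⊗[ℂ] Λ) (hy : y ∈ gens) :
    ∃ n : ℤ, ∀ t : ℂˣ, actG (tor t) y = ((t ^ n : ℂˣ) : ℂ) • y := by
  have hS : ∀ (X : 𝔤) (n : ℤ), (∀ t : ℂˣ, AdG (tor t) X = ((t ^ n : ℂˣ) : ℂ) • X) →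
      ∃ n : ℤ, ∀ t : ℂˣ, actG (tor t) (s X ⊗ₜ 1) = ((t ^ n : ℂˣ) : ℂ) • (s X ⊗ₜ 1) := by
    intro X n h
    refine ⟨n, fun t => ?_⟩
    rw [actG, Algebra.TensorProduct.map_tmul, actSG_ι, h, map_one,
      show s (((t ^ n : ℂˣ) : ℂ) • X) = ((t ^ n : ℂˣ) : ℂ) • s X from map_smul _ _ _,
      TensorProduct.smul_tmul']
  have hΛ : ∀ (l : Λ) (n : ℤ), (∀ t : ℂˣ, actΛG (tor t) l = ((t ^ n : ℂˣ) : ℂ) • l) →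
      ∃ n : ℤ, ∀ t : ℂˣ, actG (tor t) (1 ⊗ₜ l) = ((t ^ n : ℂˣ) : ℂ) • (1 ⊗ₜ l) := by
    intro l n h
    refine ⟨n, fun t => ?_⟩
    rw [actG, Algebra.TensorProduct.map_tmul, h, map_one, TensorProduct.tmul_smul]
  simp only [gens, Set.mem_insert_iff, Set.mem_singleton_iff] at hy
  rcases hy with rfl | rfl | rfl | rfl | rfl | rfl | rfl | rfl | rfl | rfl | rfl | rfl
  · exact hS _ 0 fun t => by rw [map_add, AdG_tor_H₁, AdG_tor_H₂]; simp
  · exact hS _ 0 fun t => by rw [H, map_sub, AdG_tor_H₁, AdG_tor_H₂]; simp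
  · exact hS _ 1 fun t => by rw [AdG_tor_E]; simp
  · exact hS _ (-1) fun t => by rw [AdG_tor_F]; simp
  · exact hS _ 1 fun t => by rw [AdG_E₁, tor_val]; simp
  · exact hS _ 0 fun t => by rw [AdG_E₂, tor_val]; simp
  · exact hS _ (-1) fun t => by rw [AdG_F₁, tor_inv_val]; simp
  · exact hS _ 0 fun t => by rw [AdG_F₂, tor_inv_val]; simp
  · exact hΛ _ 1 fun t => by rw [actΛG_ε₁, tor_val]; simp
  · exact hΛ _ 0 fun t => by rw [actΛG_ε₂, tor_val]; simp
  · exact hΛ _ (-1) fun t => by rw [actΛG_φ₁, tor_inv_val]; simp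
  · exact hΛ _ 0 fun t => by rw [actΛG_φ₂, tor_inv_val]; simp

theorem exists_K_rot (p q : ℝ) (h : (p : ℂ) ^ 2 + (q : ℂ) ^ 2 = 1) :
    ∃ k : K, act k = actG (rot p q h) := by
  have hdet : (blk (rot p q h).1).det = 1 := by
    rw [Matrix.det_fin_three, rot_val]
    simp [blk]
    linear_combination h
  have hmem : (⟨blk (rot p q h).1, hdet⟩ : Matrix.SpecialLinearGroup (Fin 3) ℂ) ∈ K := by
    refine ⟨?_, ?_, ?_, ?_, ?_⟩
    · rw [Matrix.mem_unitaryGroup_iff]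
      ext i j
      rw [Matrix.mul_apply, Fin.sum_univ_three]
      fin_cases i <;> fin_cases j <;> simp [blk, rot_val, Matrix.star_apply] <;>
        first | linear_combination h | ring
    all_goals simp [blk]
  exact ⟨⟨_, hmem⟩, act_eq_actG _ _ 1 (by simp)⟩

/-- A point of the unit circle that is not a root of unity. -/
def irr : ℂˣ := Units.mk0 (Complex.exp Complex.I) (Complex.exp_ne_zero _)

/-- A relation exp(in) = 1 means n = 2πm for an integer m, and the irrationality of π forces m = 0.
-/
theorem irr_zpow_eq_one (n : ℤ) (h : irr ^ n = 1) : n = 0 := by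
  have h1 : Complex.exp (n * Complex.I) = 1 := by
    rw [Complex.exp_int_mul]
    simpa [irr] using congrArg Units.val h
  obtain ⟨m, hm⟩ := Complex.exp_eq_one_iff.mp h1
  have h2 : (n : ℂ) = m * (2 * Real.pi) := by
    apply mul_right_cancel₀ Complex.I_ne_zero
    linear_combination hm
  have h3 : (n : ℝ) = m * (2 * Real.pi) := by exact_mod_cast h2
  by_cases hm0 : m = 0
  · rw [hm0] at h3; simpa using h3
  · exfalso
    have h4 := (irrational_pi.intCast_mul (m := 2 * m) (by simpa using hm0))
    apply h4
    refine ⟨n, ?_⟩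
    push_cast
    linear_combination h3

theorem exists_K_tor : ∃ k : K, act k = actG (tor irr) := by
  -- The matrix diag(exp(i), 1, 1) has determinant exp(i); the scalar exp(−i/3) corrects it to 1
  -- without changing the conjugation.
  set z : ℂ := Complex.exp (-(Complex.I / 3)) with hz
  have hz3 : Complex.exp Complex.I * z ^ 3 = 1 := by
    rw [hz, ← Complex.exp_nat_mul, ← Complex.exp_add]
    simp
    rw [← Complex.exp_zero]; congr 1; ring
  have hzz : z * star z = 1 := by
    have h3 : (starRingEnd ℂ) (3 : ℂ) = 3 := map_ofNat _ 3
    rw [hz, Complex.star_def, ← Complex.exp_conj, ← Complex.exp_add, map_neg, map_div₀,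
      Complex.conj_I, h3, ← Complex.exp_zero]
    congr 1; ring
  have hee : Complex.exp Complex.I * star (Complex.exp Complex.I) = 1 := by
    rw [Complex.star_def, ← Complex.exp_conj, ← Complex.exp_add]
    simp
  have hdet : (z • blk (tor irr).1).det = 1 := by
    rw [Matrix.det_smul, Matrix.det_fin_three, tor_val]
    simp [blk, irr]
    linear_combination hz3
  have hmem : (⟨z • blk (tor irr).1, hdet⟩ : Matrix.SpecialLinearGroup (Fin 3) ℂ) ∈ K := by
    refine ⟨?_, ?_, ?_, ?_, ?_⟩
    · rw [Matrix.mem_unitaryGroup_iff, star_smul, smul_mul_assoc, mul_smul_comm, smul_smul, hzz,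
        one_smul]
      ext i j
      rw [Matrix.mul_apply, Fin.sum_univ_three]
      fin_cases i <;> fin_cases j <;> simp [blk, tor_val, Matrix.star_apply]
      exact hee
    all_goals simp [blk]
  exact ⟨⟨_, hmem⟩, act_eq_actG _ _ z rfl⟩

/-- Invariance under `K` is the same as invariance under `GL(2, ℂ)`. -/
theorem mem_inv_iff_actG (x : S ⊗[ℂ] Λ) : x ∈ inv ↔ ∀ u, actG u x = x := by
  rw [mem_inv_iff]
  constructor
  · intro h
    have htop : stab x = ⊤ := by
      apply eq_top_of_tor_rot
      · obtain ⟨k, hk⟩ := exists_K_tor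
        exact fixed_of_weights (fun t => actG (tor t)) gens adjoin_gens gens_weight irr
          irr_zpow_eq_one x (by rw [← hk]; exact h k)
      · intro p q hpq
        obtain ⟨k, hk⟩ := exists_K_rot p q hpq
        rw [mem_stab, ← hk]
        exact h k
    intro u
    exact mem_stab.mp (htop ▸ Subgroup.mem_top u)
  · intro h k
    obtain ⟨u, hu⟩ := exists_act_eq_actG k
    rw [hu, h]

/-! ### Covariance of the coefficients -/

/-- The element of `⋀(𝔭)` with given coordinates. -/
def comb (c : Fin 16 → ℂ) : Λ := ∑ n, c n • mon n

theorem monBasis_repr_comb (c : Fin 16 → ℂ) (n : Fin 16) : monBasis.repr (comb c) n = c n := by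
  simp only [comb, ← coe_monBasis]
  exact congrFun (monBasis.repr_sum_self c) n

theorem comb_eq (c : Fin 16 → ℂ) : comb c =
    c 0 • 1 + c 1 • ε₁ + c 2 • ε₂ + c 3 • φ₁ + c 4 • φ₂ + c 5 • (ε₁ * ε₂) + c 6 • (φ₁ * φ₂) +
    c 7 • (ε₁ * φ₁) + c 8 • (ε₁ * φ₂) + c 9 • (ε₂ * φ₁) + c 10 • (ε₂ * φ₂) +
    c 11 • (ε₁ * (ε₂ * φ₁)) + c 12 • (ε₁ * (ε₂ * φ₂)) + c 13 • (ε₁ * (φ₁ * φ₂)) +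
    c 14 • (ε₂ * (φ₁ * φ₂)) + c 15 • (ε₁ * (ε₂ * (φ₁ * φ₂))) := by
  simp only [comb, Fin.sum_univ_succ, mon]
  simp [add_assoc]

/-- The action on coordinates of a matrix `m` on `ε₁, ε₂` and of `kᵀ` on `φ₁, φ₂`. -/
def cov (m k : Matrix (Fin 2) (Fin 2) ℂ) (c : Fin 16 → ℂ) : Fin 16 → ℂ :=
  ![c 0, m 0 0 * c 1 + m 0 1 * c 2, m 1 0 * c 1 + m 1 1 * c 2,
    k 0 0 * c 3 + k 1 0 * c 4, k 0 1 * c 3 + k 1 1 * c 4,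
    (m 0 0 * m 1 1 - m 0 1 * m 1 0) * c 5, (k 0 0 * k 1 1 - k 0 1 * k 1 0) * c 6,
    m 0 0 * (c 7 * k 0 0 + c 8 * k 1 0) + m 0 1 * (c 9 * k 0 0 + c 10 * k 1 0),
    m 0 0 * (c 7 * k 0 1 + c 8 * k 1 1) + m 0 1 * (c 9 * k 0 1 + c 10 * k 1 1),
    m 1 0 * (c 7 * k 0 0 + c 8 * k 1 0) + m 1 1 * (c 9 * k 0 0 + c 10 * k 1 0),
    m 1 0 * (c 7 * k 0 1 + c 8 * k 1 1) + m 1 1 * (c 9 * k 0 1 + c 10 * k 1 1),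
    (m 0 0 * m 1 1 - m 0 1 * m 1 0) * (k 0 0 * c 11 + k 1 0 * c 12),
    (m 0 0 * m 1 1 - m 0 1 * m 1 0) * (k 0 1 * c 11 + k 1 1 * c 12),
    (k 0 0 * k 1 1 - k 0 1 * k 1 0) * (m 0 0 * c 13 + m 0 1 * c 14),
    (k 0 0 * k 1 1 - k 0 1 * k 1 0) * (m 1 0 * c 13 + m 1 1 * c 14),
    (m 0 0 * m 1 1 - m 0 1 * m 1 0) * (k 0 0 * k 1 1 - k 0 1 * k 1 0) * c 15]

theorem actΛG_ε₁_mul_ε₂ (u : GL (Fin 2) ℂ) : actΛG u (ε₁ * ε₂) =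
    (u.1 0 0 * u.1 1 1 - u.1 0 1 * u.1 1 0) • (ε₁ * ε₂) := by
  rw [map_mul, actΛG_ε₁, actΛG_ε₂]
  simp only [add_mul, mul_add, smul_mul_assoc, mul_smul_comm, ε₁_sq, ε₂_sq, ε₂_mul_ε₁]
  module

theorem actΛG_φ₁_mul_φ₂ (u : GL (Fin 2) ℂ) : actΛG u (φ₁ * φ₂) =
    ((u⁻¹).1 0 0 * (u⁻¹).1 1 1 - (u⁻¹).1 0 1 * (u⁻¹).1 1 0) • (φ₁ * φ₂) := by
  rw [map_mul, actΛG_φ₁, actΛG_φ₂]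
  simp only [add_mul, mul_add, smul_mul_assoc, mul_smul_comm, φ₁_sq, φ₂_sq, φ₂_mul_φ₁]
  module

theorem actΛG_comb (u : GL (Fin 2) ℂ) (c : Fin 16 → ℂ) :
    actΛG u (comb c) = comb (cov u.1 (u⁻¹).1 c) := by
  rw [comb_eq, comb_eq]
  have h1 : actΛG u (ε₁ * (ε₂ * φ₁)) = (actΛG u (ε₁ * ε₂)) * actΛG u φ₁ := by
    rw [← map_mul, mul_assoc]
  have h2 : actΛG u (ε₁ * (ε₂ * φ₂)) = (actΛG u (ε₁ * ε₂)) * actΛG u φ₂ := by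
    rw [← map_mul, mul_assoc]
  have h3 : actΛG u (ε₁ * (ε₂ * (φ₁ * φ₂))) = (actΛG u (ε₁ * ε₂)) * actΛG u (φ₁ * φ₂) := by
    rw [← map_mul, mul_assoc]
  have h4 : actΛG u (ε₁ * (φ₁ * φ₂)) = actΛG u ε₁ * actΛG u (φ₁ * φ₂) := map_mul _ _ _
  have h5 : actΛG u (ε₂ * (φ₁ * φ₂)) = actΛG u ε₂ * actΛG u (φ₁ * φ₂) := map_mul _ _ _
  simp only [map_add, map_smul, map_one, h1, h2, h3, h4, h5, actΛG_ε₁_mul_ε₂, actΛG_φ₁_mul_φ₂]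
  simp only [map_mul, actΛG_ε₁, actΛG_ε₂, actΛG_φ₁, actΛG_φ₂]
  simp only [add_mul, mul_add, smul_mul_assoc, mul_smul_comm, mul_assoc, cov, Matrix.cons_val]
  module

/-- The element of `S(𝔤) ⊗ ⋀(𝔭)` with given coefficients. -/
def combS (c : Fin 16 → S) : S ⊗[ℂ] Λ := ∑ n, c n • SBasis n

theorem SBasis_apply (n : Fin 16) : SBasis n = 1 ⊗ₜ mon n := by
  rw [SBasis, Algebra.TensorProduct.basis_apply, coe_monBasis]

theorem combS_eq (c : Fin 16 → S) : combS c = ∑ n, c n ⊗ₜ mon n := by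
  simp only [combS, SBasis_apply, TensorProduct.smul_tmul', smul_eq_mul, mul_one]

theorem cf_combS (c : Fin 16 → S) (n : Fin 16) : cf (combS c) n = c n :=
  congrFun (SBasis.repr_sum_self c) n

theorem combS_cf (x : S ⊗[ℂ] Λ) : combS (cf x) = x := SBasis.sum_repr x

theorem combS_injective : Function.Injective combS := fun c c' h => by
  ext1 n; rw [← cf_combS c, h, cf_combS]

theorem ev_combS (Y : Matrix (Fin 3) (Fin 3) ℂ) (c : Fin 16 → S) :
    ev Y (combS c) = comb (fun n => pt Y (c n)) := by
  simp only [combS_eq, map_sum, ev_tmul, comb]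

/-- Elements are determined by their values at all points Y, so invariance reduces to scalar
identities in the entries of Y, u and u⁻¹. -/
theorem combS_mem_inv_iff (c : Fin 16 → S) : combS c ∈ inv ↔
    ∀ (u : GL (Fin 2) ℂ) (Y : Matrix (Fin 3) (Fin 3) ℂ) (n : Fin 16),
      cov u.1 (u⁻¹).1 (fun m => pt (blk (u⁻¹).1 * Y * blk u.1) (c m)) n = pt Y (c n) := by
  rw [mem_inv_iff_actG]
  constructor
  · intro h u Y n
    have := congrArg (ev Y) (h u)
    rw [ev_actG, ev_combS, ev_combS, actΛG_comb] at this
    rw [← monBasis_repr_comb (cov _ _ _), this, monBasis_repr_comb]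
  · intro h u
    apply eq_of_ev
    intro Y
    rw [ev_actG, ev_combS, ev_combS, actΛG_comb]
    congr 1
    ext n
    exact h u Y n

theorem cf_covariant {x : S ⊗[ℂ] Λ} (hx : x ∈ inv) (u : GL (Fin 2) ℂ)
    (Y : Matrix (Fin 3) (Fin 3) ℂ) (n : Fin 16) :
    pt Y (cf x n) =
      cov u.1 (u⁻¹).1 (fun m => pt (blk (u⁻¹).1 * Y * blk u.1) (cf x m)) n := by
  rw [← combS_cf x, combS_mem_inv_iff] at hx
  exact (hx u Y n).symm

/-! ### The coefficients of the explicit elements -/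

/-- The components of the covariants `N v` and `w N`, where `N = (H, 2F; 2E, -H)`,
`v = (F₁, F₂)ᵗ` and `w = (E₁, E₂)`. -/
def Nv₀ : S := s H * s F₁ + 2 * s F * s F₂
def Nv₁ : S := 2 * s E * s F₁ - s H * s F₂
def wN₀ : S := 2 * s E * s E₂ + s H * s E₁
def wN₁ : S := -(s H * s E₂) + 2 * s F * s E₁

/-- `det (v, N v)` and `det (w, w N)`. -/
def δv : S := s F₁ * Nv₁ - s F₂ * Nv₀
def δw : S := s E₁ * wN₁ - s E₂ * wN₀

theorem combS_expand (c : Fin 16 → S) : combS c =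
    c 0 ⊗ₜ 1 + c 1 ⊗ₜ ε₁ + c 2 ⊗ₜ ε₂ + c 3 ⊗ₜ φ₁ + c 4 ⊗ₜ φ₂ + c 5 ⊗ₜ (ε₁ * ε₂) +
    c 6 ⊗ₜ (φ₁ * φ₂) + c 7 ⊗ₜ (ε₁ * φ₁) + c 8 ⊗ₜ (ε₁ * φ₂) + c 9 ⊗ₜ (ε₂ * φ₁) +
    c 10 ⊗ₜ (ε₂ * φ₂) + c 11 ⊗ₜ (ε₁ * (ε₂ * φ₁)) + c 12 ⊗ₜ (ε₁ * (ε₂ * φ₂)) +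
    c 13 ⊗ₜ (ε₁ * (φ₁ * φ₂)) + c 14 ⊗ₜ (ε₂ * (φ₁ * φ₂)) + c 15 ⊗ₜ (ε₁ * (ε₂ * (φ₁ * φ₂))) := by
  simp only [combS_eq, Fin.sum_univ_succ, mon]
  simp [add_assoc]

/-- The coefficients of the elements of `T`. -/
def tbl : Fin 16 → Fin 16 → S :=
  ![![1, 0, 0, 0, 0, 0, 0, 0, 0, 0, 0, 0, 0, 0, 0, 0],
    ![0, s F₁, s F₂, 0, 0, 0, 0, 0, 0, 0, 0, 0, 0, 0, 0, 0],
    ![0, 0, 0, s E₁, s E₂, 0, 0, 0, 0, 0, 0, 0, 0, 0, 0, 0],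
    ![0, 0, 0, 0, 0, 0, 0, 1, 0, 0, 1, 0, 0, 0, 0, 0],
    ![0, 0, 0, wN₀, wN₁, 0, 0, 0, 0, 0, 0, 0, 0, 0, 0, 0],
    ![0, 0, 0, 0, 0, 0, 0, s H, 2 * s F, 2 * s E, -s H, 0, 0, 0, 0, 0],
    ![0, Nv₀, Nv₁, 0, 0, 0, 0, 0, 0, 0, 0, 0, 0, 0, 0, 0],
    ![0, 0, 0, 0, 0, 0, 0, s F₁ * s E₁, s F₁ * s E₂, s F₂ * s E₁, s F₂ * s E₂, 0, 0, 0, 0, 0],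
    ![0, 0, 0, 0, 0, 0, 0, 0, 0, 0, 0, -s F₂, s F₁, 0, 0, 0],
    ![0, 0, 0, 0, 0, 0, 0, 0, 0, 0, 0, 0, 0, s E₂, -s E₁, 0],
    ![0, 0, 0, 0, 0, 0, 0, 0, 0, 0, 0, 0, 0, 0, 0, -2],
    ![0, 0, 0, 0, 0, 0, 0, 0, 0, 0, 0, Nv₁, -Nv₀, 0, 0, 0],
    ![0, 0, 0, 0, 0, δv, 0, 0, 0, 0, 0, 0, 0, 0, 0, 0],
    ![0, 0, 0, 0, 0, 0, δw, 0, 0, 0, 0, 0, 0, 0, 0, 0],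
    ![0, 0, 0, 0, 0, 0, 0, 0, 0, 0, 0, 0, 0, -wN₁, wN₀, 0],
    ![0, 0, 0, 0, 0, 0, 0, -(Nv₀ * s E₁), -(Nv₀ * s E₂), -(Nv₁ * s E₁), -(Nv₁ * s E₂),
      0, 0, 0, 0, 0]]

theorem one_eq_combS : (1 : S ⊗[ℂ] Λ) = combS (tbl 0) := by
  rw [combS_expand]; simp [tbl, Algebra.TensorProduct.one_def]

theorem e_eq_combS : e = combS (tbl 1) := by
  rw [combS_expand]; simp [tbl, e]

theorem f_eq_combS : f = combS (tbl 2) := by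
  rw [combS_expand]; simp [tbl, f]

theorem g_eq_combS : g = combS (tbl 3) := by
  rw [combS_expand]; simp [tbl, g, TensorProduct.tmul_add]

theorem h_eq_combS : h = combS (tbl 4) := by
  rw [combS_expand]; simp [tbl, h, wN₀, wN₁]

theorem i_eq_combS : i = combS (tbl 5) := by
  rw [combS_expand]; simp [tbl, i, TensorProduct.neg_tmul]; abel

theorem j_eq_combS : j = combS (tbl 6) := by
  rw [combS_expand]; simp [tbl, j, Nv₀, Nv₁]

theorem e_eq : e = s F₁ ⊗ₜ ε₁ + s F₂ ⊗ₜ ε₂ := rfl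
theorem f_eq : f = s E₁ ⊗ₜ φ₁ + s E₂ ⊗ₜ φ₂ := rfl
theorem g_eq_add : g = 1 ⊗ₜ (ε₁ * φ₁) + 1 ⊗ₜ (ε₂ * φ₂) := TensorProduct.tmul_add _ _ _
theorem h_eq : h = wN₀ ⊗ₜ φ₁ + wN₁ ⊗ₜ φ₂ := rfl
theorem i_eq : i = (2 * s E) ⊗ₜ (ε₂ * φ₁) + s H ⊗ₜ (ε₁ * φ₁) - s H ⊗ₜ (ε₂ * φ₂) +
    (2 * s F) ⊗ₜ (ε₁ * φ₂) := rfl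
theorem j_eq : j = Nv₀ ⊗ₜ ε₁ + Nv₁ ⊗ₜ ε₂ := rfl

theorem ef_eq_combS : e * f = combS (tbl 7) := by
  refine Eq.trans ?_ (combS_expand _).symm
  simp only [e_eq, f_eq, mul_add, add_mul, Algebra.TensorProduct.tmul_mul_tmul]
  simp [tbl]
  abel

theorem eg_eq_combS : e * g = combS (tbl 8) := by
  refine Eq.trans ?_ (combS_expand _).symm
  simp only [e_eq, g_eq_add, mul_add, add_mul, Algebra.TensorProduct.tmul_mul_tmul, ε₁_sq_assoc, ε₂_sq_assoc,
    ε₂_mul_ε₁_assoc, mul_one, TensorProduct.tmul_neg]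
  simp [tbl, TensorProduct.neg_tmul]

theorem fg_eq_combS : f * g = combS (tbl 9) := by
  refine Eq.trans ?_ (combS_expand _).symm
  simp only [f_eq, g_eq_add, mul_add, add_mul, Algebra.TensorProduct.tmul_mul_tmul, φ₁_mul_ε₁_assoc,
    φ₁_mul_ε₂_assoc, φ₂_mul_ε₁_assoc, φ₂_mul_ε₂_assoc, φ₂_mul_φ₁, φ₁_sq, φ₂_sq, mul_neg, mul_zero,
    neg_zero, neg_neg, mul_one, TensorProduct.tmul_neg]
  simp [tbl, TensorProduct.neg_tmul]

theorem gg_eq_combS : g ^ 2 = combS (tbl 10) := by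
  have h2 : ((-2 : S)) = -1 - 1 := by norm_num
  refine Eq.trans ?_ (combS_expand _).symm
  simp only [pow_two, g_eq_add, mul_add, add_mul, Algebra.TensorProduct.tmul_mul_tmul, mul_assoc, φ₁_mul_ε₁_assoc,
    φ₁_mul_ε₂_assoc, φ₂_mul_ε₁_assoc, φ₂_mul_ε₂_assoc, φ₂_mul_φ₁, φ₁_sq, φ₂_sq, mul_neg, mul_zero,
    ε₂_mul_ε₁_assoc,
    neg_zero, neg_neg, mul_one, TensorProduct.tmul_neg]
  simp [tbl, TensorProduct.neg_tmul, h2, TensorProduct.sub_tmul]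
  abel

theorem ei_eq_combS : e * i = combS (tbl 11) := by
  refine Eq.trans ?_ (combS_expand _).symm
  simp only [e_eq, i_eq, mul_add, add_mul, mul_sub, Algebra.TensorProduct.tmul_mul_tmul, ε₁_sq_assoc,
    ε₂_sq_assoc, ε₂_mul_ε₁_assoc, TensorProduct.tmul_neg]
  simp [tbl, Nv₀, Nv₁, TensorProduct.neg_tmul, TensorProduct.add_tmul, TensorProduct.sub_tmul,
    mul_comm, mul_left_comm]
  abel

theorem ej_eq_combS : e * j = combS (tbl 12) := by
  refine Eq.trans ?_ (combS_expand _).symm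
  simp only [e_eq, j_eq, mul_add, add_mul, Algebra.TensorProduct.tmul_mul_tmul, ε₁_sq,
    ε₂_sq, ε₂_mul_ε₁, TensorProduct.tmul_neg]
  simp [tbl, δv, TensorProduct.sub_tmul]
  abel

theorem fh_eq_combS : f * h = combS (tbl 13) := by
  refine Eq.trans ?_ (combS_expand _).symm
  simp only [f_eq, h_eq, mul_add, add_mul, Algebra.TensorProduct.tmul_mul_tmul, φ₁_sq,
    φ₂_sq, φ₂_mul_φ₁, TensorProduct.tmul_neg]
  simp [tbl, δw, TensorProduct.sub_tmul]
  abel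

theorem fi_eq_combS : f * i = combS (tbl 14) := by
  refine Eq.trans ?_ (combS_expand _).symm
  simp only [f_eq, i_eq, mul_add, add_mul, mul_sub, Algebra.TensorProduct.tmul_mul_tmul, φ₁_mul_ε₁_assoc,
    φ₁_mul_ε₂_assoc, φ₂_mul_ε₁_assoc, φ₂_mul_ε₂_assoc, φ₂_mul_φ₁, φ₁_sq, φ₂_sq, mul_neg, mul_zero,
    neg_zero, neg_neg, TensorProduct.tmul_neg]
  simp [tbl, wN₀, wN₁, TensorProduct.neg_tmul, TensorProduct.add_tmul,
    mul_comm, mul_left_comm]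
  abel

theorem fj_eq_combS : f * j = combS (tbl 15) := by
  refine Eq.trans ?_ (combS_expand _).symm
  simp only [f_eq, j_eq, mul_add, add_mul, Algebra.TensorProduct.tmul_mul_tmul, φ₁_mul_ε₁,
    φ₁_mul_ε₂, φ₂_mul_ε₁, φ₂_mul_ε₂, TensorProduct.tmul_neg]
  simp [tbl, TensorProduct.neg_tmul, mul_comm]
  abel

theorem T_eq_combS (n : Fin 16) : T n = combS (tbl n) := by
  fin_cases n
  · exact one_eq_combS
  · exact e_eq_combS
  · exact f_eq_combS
  · exact g_eq_combS
  · exact h_eq_combS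
  · exact i_eq_combS
  · exact j_eq_combS
  · exact ef_eq_combS
  · exact eg_eq_combS
  · exact fg_eq_combS
  · exact gg_eq_combS
  · exact ei_eq_combS
  · exact ej_eq_combS
  · exact fh_eq_combS
  · exact fi_eq_combS
  · exact fj_eq_combS

/-! ### Invariance of the explicit elements -/

theorem det_ne_zero (u : GL (Fin 2) ℂ) : u.1 0 0 * u.1 1 1 - u.1 0 1 * u.1 1 0 ≠ 0 := by
  rw [← Matrix.det_fin_two]
  exact (Matrix.isUnit_iff_isUnit_det _).mp u.isUnit |>.ne_zero

theorem conj_apply (u : GL (Fin 2) ℂ) (Y : Matrix (Fin 3) (Fin 3) ℂ) :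
    blk (u⁻¹).1 * Y * blk u.1 =
    !![((u⁻¹).1 0 0 * Y 0 0 + (u⁻¹).1 0 1 * Y 1 0) * u.1 0 0 +
        ((u⁻¹).1 0 0 * Y 0 1 + (u⁻¹).1 0 1 * Y 1 1) * u.1 1 0,
      ((u⁻¹).1 0 0 * Y 0 0 + (u⁻¹).1 0 1 * Y 1 0) * u.1 0 1 +
        ((u⁻¹).1 0 0 * Y 0 1 + (u⁻¹).1 0 1 * Y 1 1) * u.1 1 1,
      (u⁻¹).1 0 0 * Y 0 2 + (u⁻¹).1 0 1 * Y 1 2;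
      ((u⁻¹).1 1 0 * Y 0 0 + (u⁻¹).1 1 1 * Y 1 0) * u.1 0 0 +
        ((u⁻¹).1 1 0 * Y 0 1 + (u⁻¹).1 1 1 * Y 1 1) * u.1 1 0,
      ((u⁻¹).1 1 0 * Y 0 0 + (u⁻¹).1 1 1 * Y 1 0) * u.1 0 1 +
        ((u⁻¹).1 1 0 * Y 0 1 + (u⁻¹).1 1 1 * Y 1 1) * u.1 1 1,
      (u⁻¹).1 1 0 * Y 0 2 + (u⁻¹).1 1 1 * Y 1 2;
      Y 2 0 * u.1 0 0 + Y 2 1 * u.1 1 0, Y 2 0 * u.1 0 1 + Y 2 1 * u.1 1 1, Y 2 2] := by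
  ext i j
  simp only [Matrix.mul_apply, Fin.sum_univ_three]
  fin_cases i <;> fin_cases j <;> simp [blk]

/-- Treating the inverse determinant as a variable `D` with the single relation D · det u = 1 makes
every later invariance check a multiple of that relation. -/
theorem exists_GL_inv_val (u : GL (Fin 2) ℂ) : ∃ D : ℂ,
    D * (u.1 0 0 * u.1 1 1 - u.1 0 1 * u.1 1 0) = 1 ∧
    (u⁻¹).1 = !![D * u.1 1 1, -(D * u.1 0 1); -(D * u.1 1 0), D * u.1 0 0] := by
  refine ⟨(u.1 0 0 * u.1 1 1 - u.1 0 1 * u.1 1 0)⁻¹, inv_mul_cancel₀ (det_ne_zero u), ?_⟩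
  rw [Matrix.coe_units_inv, Matrix.inv_def, Ring.inverse_eq_inv', Matrix.det_fin_two,
    Matrix.adjugate_fin_two]
  ext i j
  fin_cases i <;> fin_cases j <;> simp

theorem e_mem_inv : e ∈ inv := by
  rw [e_eq_combS, combS_mem_inv_iff]
  intro u Y m
  obtain ⟨D, hD, hk⟩ := exists_GL_inv_val u
  rw [conj_apply, hk]
  fin_cases m <;> simp only [tbl, cov, Matrix.cons_val, Fin.reduceFinMk, Fin.zero_eta, Fin.mk_one,
    Matrix.of_apply, map_zero, mul_zero, zero_mul, add_zero] <;>
    simp only [pt_F₁, pt_F₂, Matrix.cons_val, Matrix.of_apply]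
  · linear_combination Y 0 2 * hD
  · linear_combination Y 1 2 * hD

theorem f_mem_inv : f ∈ inv := by
  rw [f_eq_combS, combS_mem_inv_iff]
  intro u Y m
  obtain ⟨D, hD, hk⟩ := exists_GL_inv_val u
  rw [conj_apply, hk]
  fin_cases m <;> simp only [tbl, cov, Matrix.cons_val, Fin.reduceFinMk, Fin.zero_eta, Fin.mk_one,
    Matrix.of_apply, map_zero, mul_zero, zero_mul, add_zero] <;>
    simp only [pt_E₁, pt_E₂, Matrix.cons_val, Matrix.of_apply]
  · linear_combination Y 2 0 * hD
  · linear_combination Y 2 1 * hD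

theorem g_mem_inv : g ∈ inv := by
  rw [g_eq_combS, combS_mem_inv_iff]
  intro u Y m
  obtain ⟨D, hD, hk⟩ := exists_GL_inv_val u
  rw [conj_apply, hk]
  fin_cases m <;> simp only [tbl, cov, Matrix.cons_val, Fin.reduceFinMk, Fin.zero_eta, Fin.mk_one,
    Matrix.of_apply, map_zero, mul_zero, zero_mul, add_zero, map_one]
  · linear_combination hD
  · ring
  · ring
  · linear_combination hD

theorem h_mem_inv : h ∈ inv := by
  rw [h_eq_combS, combS_mem_inv_iff]
  intro u Y m
  obtain ⟨D, hD, hk⟩ := exists_GL_inv_val u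
  rw [conj_apply, hk]
  fin_cases m <;> simp only [tbl, cov, Matrix.cons_val, Fin.reduceFinMk, Fin.zero_eta, Fin.mk_one,
    Matrix.of_apply, map_zero, mul_zero, zero_mul, add_zero] <;>
    simp only [wN₀, wN₁, map_add, map_neg, map_mul, map_ofNat, pt_H,
      pt_E, pt_F, pt_E₁, pt_E₂, Matrix.cons_val, Matrix.of_apply]
  -- Here D occurs to second order, and (D det u)² − 1 = (D det u + 1)(D det u − 1).
  · linear_combination (2 * Y 1 0 * Y 2 1 + (Y 0 0 - Y 1 1) * Y 2 0) * (D * (u.1 0 0 * u.1 1 1 - u.1 0 1 * u.1 1 0) + 1) * hD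
  · linear_combination (-((Y 0 0 - Y 1 1) * Y 2 1) + 2 * Y 0 1 * Y 2 0) * (D * (u.1 0 0 * u.1 1 1 - u.1 0 1 * u.1 1 0) + 1) * hD

theorem i_mem_inv : i ∈ inv := by
  rw [i_eq_combS, combS_mem_inv_iff]
  intro u Y m
  obtain ⟨D, hD, hk⟩ := exists_GL_inv_val u
  rw [conj_apply, hk]
  fin_cases m <;> simp only [tbl, cov, Matrix.cons_val, Fin.reduceFinMk, Fin.zero_eta, Fin.mk_one,
    Matrix.of_apply, map_zero, mul_zero, add_zero] <;>
    simp only [map_neg, map_mul, map_ofNat, pt_H, pt_E, pt_F, Matrix.cons_val, Matrix.of_apply]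
  · linear_combination (Y 0 0 - Y 1 1) * (D * (u.1 0 0 * u.1 1 1 - u.1 0 1 * u.1 1 0) + 1) * hD
  · linear_combination 2 * Y 0 1 * (D * (u.1 0 0 * u.1 1 1 - u.1 0 1 * u.1 1 0) + 1) * hD
  · linear_combination 2 * Y 1 0 * (D * (u.1 0 0 * u.1 1 1 - u.1 0 1 * u.1 1 0) + 1) * hD
  · linear_combination -(Y 0 0 - Y 1 1) * (D * (u.1 0 0 * u.1 1 1 - u.1 0 1 * u.1 1 0) + 1) * hD

theorem j_mem_inv : j ∈ inv := by
  rw [j_eq_combS, combS_mem_inv_iff]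
  intro u Y m
  obtain ⟨D, hD, hk⟩ := exists_GL_inv_val u
  rw [conj_apply, hk]
  fin_cases m <;> simp only [tbl, cov, Matrix.cons_val, Fin.reduceFinMk, Fin.zero_eta, Fin.mk_one,
    Matrix.of_apply, map_zero, mul_zero, zero_mul, add_zero] <;>
    simp only [Nv₀, Nv₁, map_add, map_sub, map_mul, map_ofNat, pt_H,
      pt_E, pt_F, pt_F₁, pt_F₂, Matrix.cons_val, Matrix.of_apply]
  · linear_combination ((Y 0 0 - Y 1 1) * Y 0 2 + 2 * Y 0 1 * Y 1 2) * (D * (u.1 0 0 * u.1 1 1 - u.1 0 1 * u.1 1 0) + 1) * hD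
  · linear_combination (2 * Y 1 0 * Y 0 2 - (Y 0 0 - Y 1 1) * Y 1 2) * (D * (u.1 0 0 * u.1 1 1 - u.1 0 1 * u.1 1 0) + 1) * hD

theorem one_tmul_eq_combS (x : S) :
    x ⊗ₜ (1 : Λ) = combS ![x, 0, 0, 0, 0, 0, 0, 0, 0, 0, 0, 0, 0, 0, 0, 0] := by
  rw [combS_expand]; simp

theorem act_tmul_one (k : K) (x : S) : act k (x ⊗ₜ 1) = actS k x ⊗ₜ 1 := by
  simp [act]

/-- Lets the results on S(𝔤) ⊗ ⋀(𝔭) be applied to S(𝔤)^K as its part of exterior degree 0. -/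
theorem tmul_one_mem_inv_iff (x : S) : x ⊗ₜ (1 : Λ) ∈ inv ↔ x ∈ invS := by
  rw [mem_inv_iff, mem_invS_iff]
  refine forall_congr' fun k => ?_
  rw [act_tmul_one, one_tmul_eq_combS, one_tmul_eq_combS, combS_injective.eq_iff]
  constructor
  · intro h; exact congrFun h 0
  · intro h; rw [h]

theorem pt_a_eq (Y : Matrix (Fin 3) (Fin 3) ℂ) :
    pt Y a = (Y 0 0 + Y 1 1 - 2 * Y 2 2) / 3 := by
  rw [eq_div_iff (three_ne_zero' ℂ), ← pt_a, mul_comm]; rfl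

theorem pt_b_eq {A : Type*} [CommRing A] [Algebra ℂ A] (Y : Matrix (Fin 3) (Fin 3) A) :
    pt Y b = (Y 0 0 - Y 1 1) ^ 2 + 4 * Y 1 0 * Y 0 1 := by
  simp only [b, map_add, map_mul, map_pow, map_ofNat, pt_H, pt_E, pt_F]

theorem pt_c_eq {A : Type*} [CommRing A] [Algebra ℂ A] (Y : Matrix (Fin 3) (Fin 3) A) :
    pt Y c = Y 2 0 * Y 0 2 + Y 2 1 * Y 1 2 := by
  simp only [c, map_add, map_mul, pt_E₁, pt_E₂, pt_F₁, pt_F₂]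

theorem pt_d_eq {A : Type*} [CommRing A] [Algebra ℂ A] (Y : Matrix (Fin 3) (Fin 3) A) :
    pt Y d = 2 * Y 1 0 * Y 2 1 * Y 0 2 + (Y 0 0 - Y 1 1) * Y 2 0 * Y 0 2
      - (Y 0 0 - Y 1 1) * Y 2 1 * Y 1 2 + 2 * Y 0 1 * Y 2 0 * Y 1 2 := by
  simp only [d, map_add, map_sub, map_mul, map_ofNat, pt_E₁, pt_E₂, pt_F₁, pt_F₂, pt_H, pt_E, pt_F]

theorem mem_invS_of_pt {x : S} (h : ∀ (u : GL (Fin 2) ℂ) (Y : Matrix (Fin 3) (Fin 3) ℂ),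
    pt (blk (u⁻¹).1 * Y * blk u.1) x = pt Y x) : x ∈ invS := by
  rw [← tmul_one_mem_inv_iff, one_tmul_eq_combS, combS_mem_inv_iff]
  intro u Y m
  fin_cases m
  · exact h u Y
  all_goals simp [cov]

theorem adjoin_le_invS : Algebra.adjoin ℂ {a, b, c, d} ≤ invS := by
  rw [Algebra.adjoin_le_iff]
  intro x hx
  apply mem_invS_of_pt
  intro u Y
  obtain ⟨D, hD, hk⟩ := exists_GL_inv_val u
  rw [conj_apply, hk]
  generalize u.1 0 0 = p at *
  generalize u.1 0 1 = q at *
  generalize u.1 1 0 = r at *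
  generalize u.1 1 1 = t at *
  simp only [Set.mem_insert_iff, Set.mem_singleton_iff] at hx
  rcases hx with rfl | rfl | rfl | rfl
  · simp only [pt_a_eq, Matrix.cons_val, Matrix.of_apply]
    linear_combination (Y 0 0 + Y 1 1) / 3 * hD
  · simp only [pt_b_eq, Matrix.cons_val, Matrix.of_apply]
    linear_combination ((Y 0 0 - Y 1 1) ^ 2 + 4 * Y 1 0 * Y 0 1) * (D * (p * t - q * r) + 1) * hD
  · simp only [pt_c_eq, Matrix.cons_val, Matrix.of_apply]
    linear_combination (Y 2 0 * Y 0 2 + Y 2 1 * Y 1 2) * hD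
  · simp only [pt_d_eq, Matrix.cons_val, Matrix.of_apply]
    linear_combination (2 * Y 1 0 * Y 2 1 * Y 0 2 + (Y 0 0 - Y 1 1) * Y 2 0 * Y 0 2
      - (Y 0 0 - Y 1 1) * Y 2 1 * Y 1 2 + 2 * Y 0 1 * Y 2 0 * Y 1 2) *
      (D * (p * t - q * r) + 1) * hD

/-! ### Sections -/

section slices
variable {A : Type*} [CommRing A] [Algebra ℂ A]

/-- The section on which `v` and `N v` are the standard basis vectors. -/
def slV (q : Fin 4 → A) : Matrix (Fin 3) (Fin 3) A :=
  !![0, (1 / 2 : ℂ) • q 1, 1; algebraMap ℂ A (1 / 2), 0, 0; q 2, q 3, (-(3 / 2) : ℂ) • q 0]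

/-- The section on which `w` and `w N` are the standard basis vectors. -/
def slW (q : Fin 4 → A) : Matrix (Fin 3) (Fin 3) A :=
  !![0, algebraMap ℂ A (1 / 2), q 2; (1 / 2 : ℂ) • q 1, 0, q 3; 1, 0, (-(3 / 2) : ℂ) • q 0]

theorem pt_a_smul (Y : Matrix (Fin 3) (Fin 3) A) :
    pt Y (s (H₁ + H₂)) = (1 / 3 : ℂ) • (Y 0 0 + Y 1 1 - 2 * Y 2 2) := by
  rw [← pt_a, ← map_ofNat (algebraMap ℂ A) 3, ← Algebra.smul_def, smul_smul]
  norm_num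

theorem pt_slV_a (q : Fin 4 → A) : pt (slV q) (s (H₁ + H₂)) = q 0 := by
  rw [pt_a_smul]
  simp only [slV, Matrix.of_apply, Matrix.cons_val]
  rw [two_mul]
  module

theorem pt_slW_a (q : Fin 4 → A) : pt (slW q) (s (H₁ + H₂)) = q 0 := by
  rw [pt_a_smul]
  simp only [slW, Matrix.of_apply, Matrix.cons_val]
  rw [two_mul]
  module

theorem map_pt_slV {B : Type*} [CommRing B] [Algebra ℂ B] (r : A →ₐ[ℂ] B) (q : Fin 4 → A) (x : S) :
    r (pt (slV q) x) = pt (slV (fun n => r (q n))) x := by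
  suffices r.comp (pt (slV q)) = pt (slV (fun n => r (q n))) from DFunLike.congr_fun this x
  apply S_hom_ext
  · rw [AlgHom.comp_apply, pt_slV_a, pt_slV_a]
  all_goals simp [slV]

theorem map_pt_slW {B : Type*} [CommRing B] [Algebra ℂ B] (r : A →ₐ[ℂ] B) (q : Fin 4 → A) (x : S) :
    r (pt (slW q) x) = pt (slW (fun n => r (q n))) x := by
  suffices r.comp (pt (slW q)) = pt (slW (fun n => r (q n))) from DFunLike.congr_fun this x
  apply S_hom_ext
  · rw [AlgHom.comp_apply, pt_slW_a, pt_slW_a]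
  all_goals simp [slW]

end slices

/-- The polynomial in `a, b, c, d` with the same restriction to the section `slV`. -/
def lftV : S →ₐ[ℂ] S :=
  (MvPolynomial.aeval ![a, b, c, d]).comp (pt (slV (MvPolynomial.X : Fin 4 → MvPolynomial _ ℂ)))

/-- The polynomial in `a, b, c, d` with the same restriction to the section `slW`. -/
def lftW : S →ₐ[ℂ] S :=
  (MvPolynomial.aeval ![a, b, c, d]).comp (pt (slW (MvPolynomial.X : Fin 4 → MvPolynomial _ ℂ)))

theorem aeval_mem_adjoin (p : MvPolynomial (Fin 4) ℂ) :
    MvPolynomial.aeval ![a, b, c, d] p ∈ Algebra.adjoin ℂ {a, b, c, d} := by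
  have : ({a, b, c, d} : Set S) = Set.range ![a, b, c, d] := by
    simp only [Matrix.range_cons, Matrix.range_empty, Set.union_empty, Set.singleton_union]
  rw [this, Algebra.adjoin_range_eq_range_aeval]
  exact ⟨p, rfl⟩

theorem lftV_mem_adjoin (x : S) : lftV x ∈ Algebra.adjoin ℂ {a, b, c, d} := aeval_mem_adjoin _

theorem lftV_mem (x : S) : lftV x ∈ invS := adjoin_le_invS (aeval_mem_adjoin _)

theorem lftW_mem (x : S) : lftW x ∈ invS := adjoin_le_invS (aeval_mem_adjoin _)

theorem lftV_eq (x : S) : lftV x = pt (slV ![a, b, c, d]) x := by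
  simp only [lftV, AlgHom.comp_apply, map_pt_slV, MvPolynomial.aeval_X]

/-- On the slice w has the coordinates (wv, wNv) = (c, d). -/
theorem lftV_E₁ : lftV (s E₁) = c := by simp [lftV_eq, slV]

theorem lftV_E₂ : lftV (s E₂) = d := by simp [lftV_eq, slV]

theorem pt_lftV (Y : Matrix (Fin 3) (Fin 3) ℂ) (x : S) :
    pt Y (lftV x) = pt (slV (fun n => pt Y (![a, b, c, d] n))) x := by
  simp only [lftV, AlgHom.comp_apply, map_pt_slV, MvPolynomial.aeval_X]

theorem pt_lftW (Y : Matrix (Fin 3) (Fin 3) ℂ) (x : S) :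
    pt Y (lftW x) = pt (slW (fun n => pt Y (![a, b, c, d] n))) x := by
  simp only [lftW, AlgHom.comp_apply, map_pt_slW, MvPolynomial.aeval_X]

/-- Restriction to `slV` sends a, b, c, d to the four coordinates, so it is a left inverse of the
evaluation map. -/
theorem algebraicIndependent_abcd : AlgebraicIndependent ℂ ![a, b, c, d] := by
  have h : (pt (slV (MvPolynomial.X : Fin 4 → MvPolynomial _ ℂ))).comp
      (MvPolynomial.aeval ![a, b, c, d]) = AlgHom.id ℂ _ := by
    apply MvPolynomial.algHom_ext
    intro n
    rw [AlgHom.comp_apply, MvPolynomial.aeval_X]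
    have h4 : (4 : MvPolynomial (Fin 4) ℂ) * MvPolynomial.C (1 / 2) * (MvPolynomial.C (1 / 2)) = 1 := by
      rw [← map_ofNat (MvPolynomial.C), ← map_mul, ← map_mul, ← map_one MvPolynomial.C]; norm_num
    have h2 : (2 : MvPolynomial (Fin 4) ℂ) * MvPolynomial.C (1 / 2) = 1 := by
      rw [← map_ofNat (MvPolynomial.C), ← map_mul, ← map_one MvPolynomial.C]; norm_num
    fin_cases n
    · exact pt_slV_a _
    · simp only [Fin.mk_one, Matrix.cons_val, pt_b_eq, slV, Matrix.of_apply, MvPolynomial.smul_eq_C_mul,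
        MvPolynomial.algebraMap_eq, AlgHom.id_apply]
      linear_combination (MvPolynomial.X 1) * h4
    · simp [pt_c_eq, slV]
    · simp only [Fin.reduceFinMk, Matrix.cons_val, pt_d_eq, slV, Matrix.of_apply,
        MvPolynomial.algebraMap_eq, AlgHom.id_apply]
      linear_combination (MvPolynomial.X 3) * h2
  exact Function.LeftInverse.injective (DFunLike.congr_fun h)

/-! ### Moving frames and normal forms of generic points -/

/-- In the basis v, Nv the vector v becomes (1, 0), the row w becomes (c, d), and N acts by v ↦ Nv,
Nv ↦ bv because N² = b. This is exactly the point of `slV` with parameters a, b, c, d. -/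
theorem exists_frameV (Y : Matrix (Fin 3) (Fin 3) ℂ) (hY : pt Y δv ≠ 0) :
    ∃ (u : GL (Fin 2) ℂ) (D : ℂ), D * pt Y δv = 1 ∧
      u.1 = !![pt Y (s F₁), pt Y Nv₀; pt Y (s F₂), pt Y Nv₁] ∧
      (u⁻¹).1 = !![D * pt Y Nv₁, -(D * pt Y Nv₀); -(D * pt Y (s F₂)), D * pt Y (s F₁)] ∧
      ∀ x, pt (blk (u⁻¹).1 * Y * blk u.1) x = pt Y (lftV x) := by
  have hδ : pt Y δv = pt Y (s F₁) * pt Y Nv₁ - pt Y Nv₀ * pt Y (s F₂) := by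
    simp only [δv, map_sub, map_mul]; ring
  have hdet : (!![pt Y (s F₁), pt Y Nv₀; pt Y (s F₂), pt Y Nv₁]).det ≠ 0 := by
    rwa [Matrix.det_fin_two_of, ← hδ]
  obtain ⟨u, hu⟩ : ∃ u : GL (Fin 2) ℂ, u.1 = !![pt Y (s F₁), pt Y Nv₀; pt Y (s F₂), pt Y Nv₁] :=
    ⟨Matrix.GeneralLinearGroup.mkOfDetNeZero _ hdet, rfl⟩
  obtain ⟨D, hD, hk⟩ := exists_GL_inv_val u
  simp only [hu, Matrix.cons_val, Matrix.of_apply] at hD hk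
  rw [← hδ] at hD
  refine ⟨u, D, hD, hu, hk, ?_⟩
  intro x
  rw [pt_lftV]
  -- Both sides are algebra homomorphisms in `x`, so the eight generators of S(𝔤) suffice.
  suffices pt _ = pt _ from DFunLike.congr_fun this x
  rw [conj_apply, hk, hu]
  simp only [δv, Nv₀, Nv₁, map_add, map_sub, map_mul, map_ofNat, pt_E, pt_F, pt_H, pt_F₁, pt_F₂,
    Matrix.cons_val, Matrix.of_apply] at hD ⊢
  apply S_hom_ext
  · rw [pt_slV_a]
    change pt _ a = pt Y a
    simp only [pt_a_eq, Matrix.cons_val, Matrix.of_apply]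
    linear_combination (Y 0 0 + Y 1 1) / 3 * hD
  all_goals simp only [pt_E, pt_F, pt_H, pt_F₁, pt_F₂, pt_E₁, pt_E₂, slV, pt_b_eq, pt_c_eq, pt_d_eq,
    Matrix.cons_val, Matrix.of_apply, smul_eq_mul, Algebra.algebraMap_self, RingHom.id_apply]
  · ring
  · linear_combination 1 / 2 * hD
  · linear_combination ((Y 0 0 - Y 1 1) ^ 2 + 4 * Y 1 0 * Y 0 1) / 2 * hD
  · ring
  · linear_combination hD
  · ring

/-- The transposed argument: here the rows of u⁻¹ are w and wN, so w becomes (1, 0) and v becomes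
(c, d). -/
theorem exists_frameW (Y : Matrix (Fin 3) (Fin 3) ℂ) (hY : pt Y δw ≠ 0) :
    ∃ (u : GL (Fin 2) ℂ) (D : ℂ), D * pt Y δw = 1 ∧
      u.1 = !![D * pt Y wN₁, -(D * pt Y (s E₂)); -(D * pt Y wN₀), D * pt Y (s E₁)] ∧
      (u⁻¹).1 = !![pt Y (s E₁), pt Y (s E₂); pt Y wN₀, pt Y wN₁] ∧
      ∀ x, pt (blk (u⁻¹).1 * Y * blk u.1) x = pt Y (lftW x) := by
  have hδ : pt Y δw = pt Y (s E₁) * pt Y wN₁ - pt Y (s E₂) * pt Y wN₀ := by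
    simp only [δw, map_sub, map_mul]
  have hdet : (!![pt Y (s E₁), pt Y (s E₂); pt Y wN₀, pt Y wN₁]).det ≠ 0 := by
    rwa [Matrix.det_fin_two_of, ← hδ]
  obtain ⟨u, hu⟩ : ∃ u : GL (Fin 2) ℂ, (u⁻¹).1 = !![pt Y (s E₁), pt Y (s E₂); pt Y wN₀, pt Y wN₁] :=
    ⟨(Matrix.GeneralLinearGroup.mkOfDetNeZero _ hdet)⁻¹, by rw [inv_inv]; rfl⟩
  obtain ⟨D, hD, hk⟩ := exists_GL_inv_val u⁻¹
  rw [inv_inv] at hk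
  simp only [hu, Matrix.cons_val, Matrix.of_apply] at hD hk
  rw [← hδ] at hD
  refine ⟨u, D, hD, hk, hu, ?_⟩
  intro x
  rw [pt_lftW]
  suffices pt _ = pt _ from DFunLike.congr_fun this x
  rw [conj_apply, hk, hu]
  simp only [δw, wN₀, wN₁, map_add, map_sub, map_neg, map_mul, map_ofNat, pt_E, pt_F, pt_H, pt_E₁,
    pt_E₂, Matrix.cons_val, Matrix.of_apply] at hD ⊢
  apply S_hom_ext
  · rw [pt_slW_a]
    change pt _ a = pt Y a
    simp only [pt_a_eq, Matrix.cons_val, Matrix.of_apply]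
    linear_combination (Y 0 0 + Y 1 1) / 3 * hD
  all_goals simp only [pt_E, pt_F, pt_H, pt_F₁, pt_F₂, pt_E₁, pt_E₂, slW, pt_b_eq, pt_c_eq, pt_d_eq,
    Matrix.cons_val, Matrix.of_apply, smul_eq_mul, Algebra.algebraMap_self, RingHom.id_apply]
  · ring
  · linear_combination ((Y 0 0 - Y 1 1) ^ 2 + 4 * Y 1 0 * Y 0 1) / 2 * hD
  · linear_combination 1 / 2 * hD
  · linear_combination hD
  · ring
  · ring

/-! ### Nonvanishing and divisibility in S(𝔤) -/

theorem exists_pt_δ_ne_zero : ∃ Y : Matrix (Fin 3) (Fin 3) ℂ,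
    pt Y δv ≠ 0 ∧ pt Y δw ≠ 0 := by
  refine ⟨!![0, 1, 1; 2, 0, 0; 1, 0, 0], ?_, ?_⟩ <;> simp [δv, δw, Nv₀, Nv₁, wN₀, wN₁, map_ofNat]

theorem δv_ne_zero : δv ≠ 0 := by
  obtain ⟨Y, h, -⟩ := exists_pt_δ_ne_zero
  rintro h0; simp [h0] at h

theorem δw_ne_zero : δw ≠ 0 := by
  obtain ⟨Y, -, h⟩ := exists_pt_δ_ne_zero
  rintro h0; simp [h0] at h

theorem E₁_ne_zero : s E₁ ≠ 0 := by
  intro h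
  have := pt_E₁ (Matrix.single 2 0 (1 : ℂ))
  rw [h] at this
  simp at this

theorem two_ne_zero_S : (2 : S) ≠ 0 := by
  intro h
  have : pt (0 : Matrix (Fin 3) (Fin 3) ℂ) 2 = 2 := map_ofNat _ 2
  rw [h] at this
  simp at this

theorem prime_E₁ : Prime (s E₁) := by
  let bs : Module.Basis (Fin 8) ℂ 𝔤 := Module.Basis.ofEquivFun gEquiv
  rw [← MulEquiv.prime_iff (SymmetricAlgebra.equivMvPolynomial bs)]
  have hE : E₁ = bs 4 := by
    rw [Module.Basis.coe_ofEquivFun, LinearEquiv.eq_symm_apply]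
    ext n
    fin_cases n <;> simp [gEquiv, E₁, offDiag, unit]
  rw [hE, SymmetricAlgebra.equivMvPolynomial_ι_apply]
  exact MvPolynomial.X_prime

theorem not_E₁_dvd_E₂ : ¬ s E₁ ∣ s E₂ := by
  rintro ⟨x, hx⟩
  have := congrArg (pt (Matrix.single 2 1 (1 : ℂ))) hx
  simp at this

/-- A row (x, y) proportional to w is a polynomial multiple of w, since E₁ is prime and does not
divide E₂. -/
theorem exists_eq_mul_E {x y : S} (h : s E₂ * x = s E₁ * y) :
    ∃ z, x = z * s E₁ ∧ y = z * s E₂ := by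
  obtain ⟨z, rfl⟩ := (prime_E₁.dvd_or_dvd (Dvd.intro _ h.symm)).resolve_left not_E₁_dvd_E₂
  refine ⟨z, mul_comm _ _, ?_⟩
  apply mul_left_cancel₀ E₁_ne_zero
  rw [← h]; ring

theorem c_eq : c = s E₁ * s F₁ + s E₂ * s F₂ := rfl

theorem d_eq : d = s E₁ * Nv₀ + s E₂ * Nv₁ := by
  simp only [d, Nv₀, Nv₁]; ring

/-! ### Coefficients of an invariant in the moving frames -/

theorem pt_cf_frameV {x : S ⊗[ℂ] Λ} (hx : x ∈ inv) (Y : Matrix (Fin 3) (Fin 3) ℂ)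
    (hY : pt Y δv ≠ 0) :
    ∃ D : ℂ, D * pt Y δv = 1 ∧ ∀ n, pt Y (cf x n) =
      cov !![pt Y (s F₁), pt Y Nv₀; pt Y (s F₂), pt Y Nv₁]
        !![D * pt Y Nv₁, -(D * pt Y Nv₀); -(D * pt Y (s F₂)), D * pt Y (s F₁)]
        (fun m => pt Y (lftV (cf x m))) n := by
  obtain ⟨u, D, hD, hu, hk, h⟩ := exists_frameV Y hY
  refine ⟨D, hD, fun n => ?_⟩
  rw [cf_covariant hx u Y n, hu, hk]
  simp only [← hu, ← hk, h]

theorem pt_cf_frameW {x : S ⊗[ℂ] Λ} (hx : x ∈ inv) (Y : Matrix (Fin 3) (Fin 3) ℂ)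
    (hY : pt Y δw ≠ 0) :
    ∃ D : ℂ, D * pt Y δw = 1 ∧ ∀ n, pt Y (cf x n) =
      cov !![D * pt Y wN₁, -(D * pt Y (s E₂)); -(D * pt Y wN₀), D * pt Y (s E₁)]
        !![pt Y (s E₁), pt Y (s E₂); pt Y wN₀, pt Y wN₁]
        (fun m => pt Y (lftW (cf x m))) n := by
  obtain ⟨u, D, hD, hu, hk, h⟩ := exists_frameW Y hY
  refine ⟨D, hD, fun n => ?_⟩
  rw [cf_covariant hx u Y n, hu, hk]
  simp only [← hu, ← hk, h]

theorem cf_zero {x : S ⊗[ℂ] Λ} (hx : x ∈ inv) : cf x 0 = lftV (cf x 0) := by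
  refine eq_of_pt δv_ne_zero fun Y hY => ?_
  obtain ⟨D, hD, h⟩ := pt_cf_frameV hx Y hY
  exact h 0

/-- The V-component is u applied to its value on the slice, and the columns of u are v and Nv. -/
theorem cf_one {x : S ⊗[ℂ] Λ} (hx : x ∈ inv) :
    cf x 1 = s F₁ * lftV (cf x 1) + Nv₀ * lftV (cf x 2) := by
  refine eq_of_pt δv_ne_zero fun Y hY => ?_
  obtain ⟨D, hD, h⟩ := pt_cf_frameV hx Y hY
  rw [map_add, map_mul, map_mul]
  exact h 1

theorem cf_two {x : S ⊗[ℂ] Λ} (hx : x ∈ inv) :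
    cf x 2 = s F₂ * lftV (cf x 1) + Nv₁ * lftV (cf x 2) := by
  refine eq_of_pt δv_ne_zero fun Y hY => ?_
  obtain ⟨D, hD, h⟩ := pt_cf_frameV hx Y hY
  rw [map_add, map_mul, map_mul]
  exact h 2

/-- The V*-component is a row times u⁻¹, so the frame with rows w, wN avoids denominators. -/
theorem cf_three {x : S ⊗[ℂ] Λ} (hx : x ∈ inv) :
    cf x 3 = s E₁ * lftW (cf x 3) + wN₀ * lftW (cf x 4) := by
  refine eq_of_pt δw_ne_zero fun Y hY => ?_
  obtain ⟨D, hD, h⟩ := pt_cf_frameW hx Y hY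
  rw [map_add, map_mul, map_mul]
  exact h 3

theorem cf_four {x : S ⊗[ℂ] Λ} (hx : x ∈ inv) :
    cf x 4 = s E₂ * lftW (cf x 3) + wN₁ * lftW (cf x 4) := by
  refine eq_of_pt δw_ne_zero fun Y hY => ?_
  obtain ⟨D, hD, h⟩ := pt_cf_frameW hx Y hY
  rw [map_add, map_mul, map_mul]
  exact h 4

/-- Λ²V transforms by det u, which is δv in this frame. -/
theorem cf_five {x : S ⊗[ℂ] Λ} (hx : x ∈ inv) : cf x 5 = δv * lftV (cf x 5) := by
  refine eq_of_pt δv_ne_zero fun Y hY => ?_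
  obtain ⟨D, hD, h⟩ := pt_cf_frameV hx Y hY
  rw [h 5]
  simp only [cov, Matrix.cons_val, Matrix.of_apply, δv, map_mul, map_sub]
  ring

theorem cf_six {x : S ⊗[ℂ] Λ} (hx : x ∈ inv) : cf x 6 = δw * lftW (cf x 6) := by
  refine eq_of_pt δw_ne_zero fun Y hY => ?_
  obtain ⟨D, hD, h⟩ := pt_cf_frameW hx Y hY
  rw [h 6]
  simp only [cov, Matrix.cons_val, Matrix.of_apply, δw, map_mul, map_sub]

/-- Λ²V ⊗ V* transforms by det u · u⁻¹, an adjugate, so the denominator D cancels. -/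
theorem cf_eleven {x : S ⊗[ℂ] Λ} (hx : x ∈ inv) :
    cf x 11 = Nv₁ * lftV (cf x 11) - s F₂ * lftV (cf x 12) := by
  refine eq_of_pt δv_ne_zero fun Y hY => ?_
  obtain ⟨D, hD, h⟩ := pt_cf_frameV hx Y hY
  rw [h 11]
  simp only [cov, Matrix.cons_val, Matrix.of_apply, δv, map_mul, map_sub] at hD ⊢
  linear_combination (pt Y Nv₁ * pt Y (lftV (cf x 11)) - pt Y (s F₂) * pt Y (lftV (cf x 12))) * hD

theorem cf_twelve {x : S ⊗[ℂ] Λ} (hx : x ∈ inv) :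
    cf x 12 = -Nv₀ * lftV (cf x 11) + s F₁ * lftV (cf x 12) := by
  refine eq_of_pt δv_ne_zero fun Y hY => ?_
  obtain ⟨D, hD, h⟩ := pt_cf_frameV hx Y hY
  rw [h 12]
  simp only [cov, Matrix.cons_val, Matrix.of_apply, δv, map_mul, map_sub, map_add, map_neg] at hD ⊢
  linear_combination (-pt Y Nv₀ * pt Y (lftV (cf x 11)) + pt Y (s F₁) * pt Y (lftV (cf x 12))) * hD

/-- V ⊗ Λ²V* transforms by det(u⁻¹) · u, the adjugate of the matrix with rows w, wN. -/
theorem cf_thirteen {x : S ⊗[ℂ] Λ} (hx : x ∈ inv) :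
    cf x 13 = wN₁ * lftW (cf x 13) - s E₂ * lftW (cf x 14) := by
  refine eq_of_pt δw_ne_zero fun Y hY => ?_
  obtain ⟨D, hD, h⟩ := pt_cf_frameW hx Y hY
  rw [h 13]
  simp only [cov, Matrix.cons_val, Matrix.of_apply, δw, map_mul, map_sub] at hD ⊢
  linear_combination (pt Y wN₁ * pt Y (lftW (cf x 13)) - pt Y (s E₂) * pt Y (lftW (cf x 14))) * hD

theorem cf_fourteen {x : S ⊗[ℂ] Λ} (hx : x ∈ inv) :
    cf x 14 = -wN₀ * lftW (cf x 13) + s E₁ * lftW (cf x 14) := by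
  refine eq_of_pt δw_ne_zero fun Y hY => ?_
  obtain ⟨D, hD, h⟩ := pt_cf_frameW hx Y hY
  rw [h 14]
  simp only [cov, Matrix.cons_val, Matrix.of_apply, δw, map_mul, map_sub, map_add, map_neg] at hD ⊢
  linear_combination (-pt Y wN₀ * pt Y (lftW (cf x 13)) + pt Y (s E₁) * pt Y (lftW (cf x 14))) * hD

/-- In top degree the factors det u and det u⁻¹ cancel, so this coefficient is itself an invariant.
-/
theorem cf_fifteen {x : S ⊗[ℂ] Λ} (hx : x ∈ inv) : cf x 15 = lftV (cf x 15) := by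
  refine eq_of_pt δv_ne_zero fun Y hY => ?_
  obtain ⟨D, hD, h⟩ := pt_cf_frameV hx Y hY
  rw [h 15]
  simp only [cov, Matrix.cons_val, Matrix.of_apply, δv, map_mul, map_sub] at hD ⊢
  linear_combination (D * (pt Y (s F₁) * pt Y Nv₁ - pt Y (s F₂) * pt Y Nv₀) + 1) *
    pt Y (lftV (cf x 15)) * hD

/-- On the section `slW`, subtracting multiples of `1` and `N` kills the second column of the
`V ⊗ V*`-component. -/
theorem cf_sub_row_zero {x : S ⊗[ℂ] Λ} (hx : x ∈ inv) :
    s E₂ * (cf x 7 - lftW (cf x 10) - lftW (cf x 8) * s H) =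
      s E₁ * (cf x 8 - lftW (cf x 8) * (2 * s F)) := by
  -- On `slW` the matrix N is (0, 1; b, 0), so its multiplier is the upper entry of the second
  -- column and the multiplier of 1 is the lower one. What survives is a column times the first row
  -- of u⁻¹, which is w.
  refine eq_of_pt δw_ne_zero fun Y hY => ?_
  obtain ⟨D, hD, h⟩ := pt_cf_frameW hx Y hY
  simp only [map_mul, map_sub]
  rw [h 7, h 8]
  simp only [cov, Matrix.cons_val, Matrix.of_apply, δw, wN₀, wN₁, map_mul, map_sub, map_add, map_neg,
    map_ofNat] at hD ⊢
  linear_combination (pt Y (s E₂) * pt Y (lftW (cf x 10)) +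
    pt Y (s E₂) * pt Y (s H) * pt Y (lftW (cf x 8)) -
    2 * pt Y (s E₁) * pt Y (s F) * pt Y (lftW (cf x 8))) * hD

theorem cf_sub_row_one {x : S ⊗[ℂ] Λ} (hx : x ∈ inv) :
    s E₂ * (cf x 9 - lftW (cf x 8) * (2 * s E)) =
      s E₁ * (cf x 10 - lftW (cf x 10) - lftW (cf x 8) * -s H) := by
  refine eq_of_pt δw_ne_zero fun Y hY => ?_
  obtain ⟨D, hD, h⟩ := pt_cf_frameW hx Y hY
  simp only [map_mul, map_sub]
  rw [h 9, h 10]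
  simp only [cov, Matrix.cons_val, Matrix.of_apply, δw, wN₀, wN₁, map_mul, map_sub, map_add, map_neg,
    map_ofNat] at hD ⊢
  linear_combination (2 * pt Y (s E₂) * pt Y (s E) * pt Y (lftW (cf x 8)) -
    pt Y (s E₁) * pt Y (lftW (cf x 10)) +
    pt Y (s E₁) * pt Y (s H) * pt Y (lftW (cf x 8))) * hD

/-- If the `V ⊗ V*`-component is `z ⊗ w`, then `z` is a combination of `v` and `N v`. -/
theorem cf_of_rank_one {x : S ⊗[ℂ] Λ} (hx : x ∈ inv) {z₀ z₁ : S} (h7 : cf x 7 = z₀ * s E₁)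
    (h8 : cf x 8 = z₀ * s E₂)
    (h9 : cf x 9 = z₁ * s E₁) (h10 : cf x 10 = z₁ * s E₂) :
    cf x 7 = (s F₁ * lftV z₀ + Nv₀ * lftV z₁) * s E₁ ∧
    cf x 8 = (s F₁ * lftV z₀ + Nv₀ * lftV z₁) * s E₂ ∧
    cf x 9 = (s F₂ * lftV z₀ + Nv₁ * lftV z₁) * s E₁ ∧
    cf x 10 = (s F₂ * lftV z₀ + Nv₁ * lftV z₁) * s E₂ := by
  -- On `slV` the component is a column times (c, d) = w(v | Nv); the inverse frame on the right
  -- turns (c, d) back into w, and the frame on the left expands the column in v and Nv.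
  refine ⟨?_, ?_, ?_, ?_⟩ <;> refine eq_of_pt δv_ne_zero fun Y hY => ?_ <;>
    obtain ⟨D, hD, h⟩ := pt_cf_frameV hx Y hY <;> rw [h] <;>
    simp only [cov, Matrix.cons_val, Matrix.of_apply, δv, map_mul, map_sub, map_add, h7, h8, h9,
      h10, lftV_E₁, lftV_E₂, c_eq, d_eq] at hD ⊢
  · linear_combination (pt Y (s F₁) * pt Y (lftV z₀) + pt Y Nv₀ * pt Y (lftV z₁)) *
      pt Y (s E₁) * hD
  · linear_combination (pt Y (s F₁) * pt Y (lftV z₀) + pt Y Nv₀ * pt Y (lftV z₁)) *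
      pt Y (s E₂) * hD
  · linear_combination (pt Y (s F₂) * pt Y (lftV z₀) + pt Y Nv₁ * pt Y (lftV z₁)) *
      pt Y (s E₁) * hD
  · linear_combination (pt Y (s F₂) * pt Y (lftV z₀) + pt Y Nv₁ * pt Y (lftV z₁)) *
      pt Y (s E₂) * hD

/-! ### Generation -/

theorem tmul_one_mul_combS (p : S) (q : Fin 16 → S) :
    (p ⊗ₜ (1 : Λ)) * combS q = combS (fun m => p * q m) := by
  simp only [combS_eq, Finset.mul_sum, Algebra.TensorProduct.tmul_mul_tmul, one_mul]

theorem combS_sub (p q : Fin 16 → S) : combS p - combS q = combS (p - q) := by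
  simp only [combS_eq, Pi.sub_apply, TensorProduct.sub_tmul, Finset.sum_sub_distrib]

theorem sum_tmul_one_mul_combS (p : Fin 16 → S) (q : Fin 16 → Fin 16 → S) :
    ∑ n, (p n ⊗ₜ (1 : Λ)) * combS (q n) = combS (fun m => ∑ n, p n * q n m) := by
  simp only [tmul_one_mul_combS]
  simp only [combS, Finset.sum_smul]
  exact Finset.sum_comm

theorem cf_sub_mul_combS (x : S ⊗[ℂ] Λ) (p q : S) (u v : Fin 16 → S) :
    cf (x - (p ⊗ₜ 1) * combS u - (q ⊗ₜ 1) * combS v) =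
      cf x - (fun m => p * u m) - fun m => q * v m := by
  apply combS_injective
  simp only [← combS_sub, combS_cf, tmul_one_mul_combS]

/-- Subtracting p g + q i keeps the element invariant and makes its V ⊗ V*-component of the form z ⊗
w, to which `cf_of_rank_one` applies. -/
theorem exists_block {x : S ⊗[ℂ] Λ} (hx : x ∈ inv) : ∃ p ∈ invS, ∃ q ∈ invS, ∃ r ∈ invS,
    ∃ t ∈ invS,
    cf x 7 = p + q * s H + (s F₁ * r + Nv₀ * t) * s E₁ ∧
    cf x 8 = q * (2 * s F) + (s F₁ * r + Nv₀ * t) * s E₂ ∧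
    cf x 9 = q * (2 * s E) + (s F₂ * r + Nv₁ * t) * s E₁ ∧
    cf x 10 = p + q * -s H + (s F₂ * r + Nv₁ * t) * s E₂ := by
  set p := lftW (cf x 10) with hp
  set q := lftW (cf x 8) with hq
  obtain ⟨y, hy, hcf⟩ : ∃ y ∈ inv, cf y = cf x - (fun m => p * tbl 3 m) - fun m => q * tbl 5 m := by
    refine ⟨_, sub_mem (sub_mem hx
      (mul_mem ((tmul_one_mem_inv_iff p).mpr (lftW_mem _)) g_mem_inv))
      (mul_mem ((tmul_one_mem_inv_iff q).mpr (lftW_mem _)) i_mem_inv), ?_⟩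
    simp only [g_eq_combS, i_eq_combS]
    exact cf_sub_mul_combS x p q _ _
  have h7 : cf y 7 = cf x 7 - p - q * s H := by rw [hcf]; simp [tbl]
  have h8 : cf y 8 = cf x 8 - q * (2 * s F) := by rw [hcf]; simp [tbl]
  have h9 : cf y 9 = cf x 9 - q * (2 * s E) := by rw [hcf]; simp [tbl]
  have h10 : cf y 10 = cf x 10 - p - q * -s H := by rw [hcf]; simp [tbl]
  obtain ⟨z₀, k7, k8⟩ := exists_eq_mul_E (cf_sub_row_zero hx)
  obtain ⟨z₁, k9, k10⟩ := exists_eq_mul_E (cf_sub_row_one hx)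
  rw [← hp, ← hq, ← h7] at k7
  rw [← hq, ← h8] at k8
  rw [← hq, ← h9] at k9
  rw [← hp, ← hq, ← h10] at k10
  obtain ⟨l7, l8, l9, l10⟩ := cf_of_rank_one hy k7 k8 k9 k10
  refine ⟨p, lftW_mem _, q, lftW_mem _, lftV z₀, lftV_mem _, lftV z₁, lftV_mem _, ?_, ?_, ?_, ?_⟩
  · linear_combination l7 - h7
  · linear_combination l8 - h8
  · linear_combination l9 - h9
  · linear_combination l10 - h10

theorem exists_coefficients {x : S ⊗[ℂ] Λ} (hx : x ∈ inv) :
    ∃ p : Fin 16 → invS, x = ∑ n, ((p n : S) ⊗ₜ (1 : Λ)) * T n := by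
  obtain ⟨p, hp, q, hq, r, hr, t, ht, h7, h8, h9, h10⟩ := exists_block hx
  have hhalf : (2 : S) * algebraMap ℂ S (1 / 2) = 1 := by
    rw [← map_ofNat (algebraMap ℂ S) 2, ← map_mul]; norm_num
  -- The signs and the factor 1/2 undo those in `tbl`: g² has coefficient −2, and the rows of fg, fi
  -- and fj are the negatives of the vectors in the frame formulas.
  refine ⟨![⟨_, lftV_mem (cf x 0)⟩, ⟨_, lftV_mem (cf x 1)⟩, ⟨_, lftW_mem (cf x 3)⟩, ⟨p, hp⟩,
    ⟨_, lftW_mem (cf x 4)⟩, ⟨q, hq⟩, ⟨_, lftV_mem (cf x 2)⟩, ⟨r, hr⟩, ⟨_, lftV_mem (cf x 12)⟩,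
    -⟨_, lftW_mem (cf x 14)⟩, -(algebraMap ℂ invS (1 / 2) * ⟨_, lftV_mem (cf x 15)⟩),
    ⟨_, lftV_mem (cf x 11)⟩, ⟨_, lftV_mem (cf x 5)⟩, ⟨_, lftW_mem (cf x 6)⟩,
    -⟨_, lftW_mem (cf x 13)⟩, -⟨t, ht⟩], ?_⟩
  simp only [T_eq_combS]
  rw [sum_tmul_one_mul_combS]
  conv_lhs => rw [← combS_cf x]
  congr 1
  ext m
  simp only [Fin.sum_univ_succ, Fin.sum_univ_zero]
  fin_cases m
  all_goals simp [tbl]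
  · exact cf_zero hx
  · linear_combination cf_one hx
  · linear_combination cf_two hx
  · linear_combination cf_three hx
  · linear_combination cf_four hx
  · linear_combination cf_five hx
  · linear_combination cf_six hx
  · linear_combination h7
  · linear_combination h8
  · linear_combination h9
  · linear_combination h10
  · linear_combination cf_eleven hx
  · linear_combination cf_twelve hx
  · linear_combination cf_thirteen hx
  · linear_combination cf_fourteen hx
  · simp at hhalf
    linear_combination cf_fifteen hx - lftV (cf x 15) * hhalf

/-! ### Independence -/

/-- Two linear equations with nonzero determinant have only the trivial solution. -/
theorem eq_zero_of_det {R : Type*} [CommRing R] [IsDomain R] {p q m₀₀ m₀₁ m₁₀ m₁₁ δ : R}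
    (hδ : δ ≠ 0) (hdet : m₀₀ * m₁₁ - m₁₀ * m₀₁ = δ) (h0 : p * m₀₀ + q * m₀₁ = 0)
    (h1 : p * m₁₀ + q * m₁₁ = 0) : p = 0 ∧ q = 0 := by
  constructor
  · apply (mul_eq_zero.mp (?_ : δ * p = 0)).resolve_left hδ
    rw [← hdet]; linear_combination m₁₁ * h0 - m₀₁ * h1
  · apply (mul_eq_zero.mp (?_ : δ * q = 0)).resolve_left hδ
    rw [← hdet]; linear_combination m₀₀ * h1 - m₁₀ * h0

theorem eq_zero_of_frameV {p q : S} (h0 : p * s F₁ + q * Nv₀ = 0)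
    (h1 : p * s F₂ + q * Nv₁ = 0) : p = 0 ∧ q = 0 :=
  eq_zero_of_det δv_ne_zero rfl h0 h1

theorem eq_zero_of_frameW {p q : S} (h0 : p * s E₁ + q * wN₀ = 0)
    (h1 : p * s E₂ + q * wN₁ = 0) : p = 0 ∧ q = 0 :=
  eq_zero_of_det δw_ne_zero rfl h0 h1

/-- The table splits by bidegree in the ε's and φ's. Outside V ⊗ V* the blocks are nonzero scalars
or 2 × 2 systems whose determinants are δv or δw up to sign. -/
theorem coefficients_eq_zero {p : Fin 16 → S} (h : ∀ m, ∑ n, p n * tbl n m = 0) : p = 0 := by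
  simp only [Fin.sum_univ_succ, Fin.sum_univ_zero] at h
  have h0 := h 0
  have h1 := h 1
  have h2 := h 2
  have h3 := h 3
  have h4 := h 4
  have h5 := h 5
  have h6 := h 6
  have h7 := h 7
  have h8 := h 8
  have h9 := h 9
  have h10 := h 10
  have h11 := h 11
  have h12 := h 12
  have h13 := h 13
  have h14 := h 14
  have h15 := h 15
  clear h
  simp [tbl] at h0 h1 h2 h3 h4 h5 h6 h7 h8 h9 h10 h11 h12 h13 h14 h15
  obtain ⟨k1, k6⟩ := eq_zero_of_frameV h1 h2
  obtain ⟨k2, k4⟩ := eq_zero_of_frameW h3 h4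
  have k12 := h5.resolve_right δv_ne_zero
  have k13 := h6.resolve_right δw_ne_zero
  have k10 := h15.resolve_right two_ne_zero_S
  obtain ⟨k8, k11⟩ := eq_zero_of_frameV (p := p 8) (q := -p 11)
    (by linear_combination h12) (by linear_combination -h11)
  obtain ⟨k9, k14⟩ := eq_zero_of_frameW (p := p 9) (q := -p 14)
    (by linear_combination -h14) (by linear_combination h13)
  -- Multiplying the V ⊗ V*-block by the column (−E₂, E₁), which w annihilates, removes the ef and
  -- fj terms. Pairing the result with w on the left then removes the g term and leaves δw times the
  -- coefficient of i.
  have hA : 2 * s F * s E₁ * p 5 - s E₂ * p 3 - s E₂ * s H * p 5 = 0 := by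
    linear_combination s E₁ * h8 - s E₂ * h7
  have hB : s E₁ * p 3 - s H * s E₁ * p 5 - 2 * s E * s E₂ * p 5 = 0 := by
    linear_combination s E₁ * h10 - s E₂ * h9
  have k5 : p 5 = 0 := by
    refine (mul_eq_zero.mp (?_ : δw * p 5 = 0)).resolve_left δw_ne_zero
    simp only [δw, wN₀, wN₁]
    linear_combination s E₁ * hA + s E₂ * hB
  have k3 : p 3 = 0 := by
    rw [k5] at hB
    refine (mul_eq_zero.mp (?_ : s E₁ * p 3 = 0)).resolve_left E₁_ne_zero
    linear_combination hB
  rw [k3, k5] at h7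
  rw [k5] at h9
  obtain ⟨k7, k15⟩ := eq_zero_of_frameV (p := p 7) (q := -p 15)
    (mul_left_cancel₀ E₁_ne_zero (by linear_combination h7))
    (mul_left_cancel₀ E₁_ne_zero (by linear_combination h9))
  rw [neg_eq_zero] at k11 k14 k15
  ext n
  fin_cases n
  exacts [h0, k1, k2, k3, k4, k5, k6, k7, k8, k9, k10, k11, k12, k13, k14, k15]

/-! ### The module of invariants -/

theorem T_mem_inv (n : Fin 16) : T n ∈ inv := by
  fin_cases n
  exacts [one_mem _, e_mem_inv, f_mem_inv, g_mem_inv, h_mem_inv, i_mem_inv, j_mem_inv,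
    mul_mem e_mem_inv f_mem_inv, mul_mem e_mem_inv g_mem_inv, mul_mem f_mem_inv g_mem_inv,
    pow_mem g_mem_inv 2, mul_mem e_mem_inv i_mem_inv, mul_mem e_mem_inv j_mem_inv,
    mul_mem f_mem_inv h_mem_inv, mul_mem f_mem_inv i_mem_inv, mul_mem f_mem_inv j_mem_inv]

/-- An invariant x equals `lftV x`, which is a polynomial in a, b, c, d by construction. -/
theorem adjoin_eq_invS : Algebra.adjoin ℂ {a, b, c, d} = invS := by
  refine le_antisymm adjoin_le_invS fun x hx => ?_
  have h0 := cf_zero ((tmul_one_mem_inv_iff x).mpr hx)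
  have hx0 : cf (x ⊗ₜ 1) 0 = x := by rw [one_tmul_eq_combS, cf_combS]; simp
  rw [hx0] at h0
  rw [h0]
  exact lftV_mem_adjoin x

/-- The elements of `T` as elements of the algebra of invariants. -/
def invT (n : Fin 16) : inv := ⟨T n, T_mem_inv n⟩

theorem coe_sum_smul_invT (p : Fin 16 → invS) :
    ((∑ n, p n • invT n : inv) : S ⊗[ℂ] Λ) = ∑ n, ((p n : S) ⊗ₜ (1 : Λ)) * T n := by
  rw [AddSubmonoidClass.coe_finsetSum]
  rfl

theorem linearIndependent_invT : LinearIndependent invS invT := by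
  rw [Fintype.linearIndependent_iffₛ]
  intro p q hpq n
  have h := congrArg (Subtype.val : inv → S ⊗[ℂ] Λ) hpq
  simp only [coe_sum_smul_invT, T_eq_combS, sum_tmul_one_mul_combS] at h
  have h0 : (fun n => (p n : S) - q n) = 0 := by
    refine coefficients_eq_zero fun m => ?_
    simp only [sub_mul, Finset.sum_sub_distrib]
    exact sub_eq_zero.mpr (congrFun (combS_injective h) m)
  exact Subtype.ext (sub_eq_zero.mp (congrFun h0 n))

theorem span_invT : ⊤ ≤ Submodule.span invS (Set.range invT) := fun x _ => by
  obtain ⟨p, hp⟩ := exists_coefficients x.2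
  rw [Submodule.mem_span_range_iff_exists_fun]
  exact ⟨p, Subtype.ext ((coe_sum_smul_invT p).trans hp.symm)⟩

/-- The basis `T` of the module of invariants. -/
def basisT : Module.Basis (Fin 16) invS inv :=
  Module.Basis.mk linearIndependent_invT span_invT

theorem coe_basisT (n : Fin 16) : (basisT n : S ⊗[ℂ] Λ) = T n := by
  rw [basisT, Module.Basis.mk_apply]; rfl

end SU21

end

theorem mainTheorem4 :
    -- `S(𝔤)^K` is the polynomial algebra generated by `a, b, c, d`
    (AlgebraicIndependent ℂ ![SU21.a, SU21.b, SU21.c, SU21.d] ∧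
      Algebra.adjoin ℂ {SU21.a, SU21.b, SU21.c, SU21.d} = SU21.invS) ∧
    -- `(S(𝔤) ⊗ ⋀(𝔭))^K` is a free `S(𝔤)^K`-module of rank `16` with basis `T`
    (Module.Free SU21.invS SU21.inv ∧ Module.rank SU21.invS SU21.inv = 16 ∧
      ∃ B : Module.Basis (Fin 16) SU21.invS SU21.inv,
        ∀ n, (B n : TensorProduct ℂ SU21.S SU21.Λ) = SU21.T n) := by
  refine ⟨⟨SU21.algebraicIndependent_abcd, SU21.adjoin_eq_invS⟩, Module.Free.of_basis SU21.basisT,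
    ?_, SU21.basisT, SU21.coe_basisT⟩
  rw [rank_eq_card_basis SU21.basisT]
  simp
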